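/- Let $n\ge 2$, let $Q\subseteq\{1,\dots,n-1\}$ be nonempty, let $\lambda=(\lambda_1\ge\dots\ge\lambda_n\ge 0)$ be an $n$-partition, with Young diagram having column lengths $\zeta_1\ge\dots\ge\zeta_{\lambda_1}$, such that every column length less than $n$ belongs to $Q$, and let $\pi=(P_q)_{q\in Q}$ be a $Q$-chain, i.e. subsets $P_q\subseteq[n]$ with $|P_q|=q$ and $P_q\subset P_{q'}$ for $q<q'$. A tabloid of shape $\lambda$ is a filling of the diagram with values in $[n]$ that strictly increases down each column; a tableau is a tabloid whose values weakly increase along each row. Compare fillings entrywise: $T\preceq U$ if $T(r,c)\le U(r,c)$ for all locations. The $\lambda$-key $Y_\lambda(\pi)$ is the tabloid whose columns of length $q\in Q$ contain the elements of $P_q$ and whose columns of length $n$ contain the elements of $[n]$, in increasing order. The scanning tableau $S(T)$ of a tableau $T$ is the following filling of the same shape. For each column index $c$, ignore the columns of $T$ to the left of column $c$ and fill column $c$ of $S(T)$ from bottom to top by repeating this step: from the sequence, read left to right, of the lowest unmarked values of the columns that still have unmarked locations, take the earliest weakly increasing subsequence (it begins with the first member, and each further member is the next one that is at least as large as the member last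 taken); write its last value in the lowest empty location of column $c$ of $S(T)$; mark in $T$ the locations of its members. All marks are erased before passing to the next $c$. Call a tableau $T$ of shape $\lambda$ $\pi$-Demazure if $S(T)\preceq Y_\lambda(\pi)$. For a commutative ring $R$, the monomial of a tabloid $T$ is the product over the columns $c$ of the minors of the generic matrix $(x_{ij})_{1\le i,j\le n}$ with rows $T(1,c),\dots,T(\zeta_c,c)$ and columns $1,\dots,\zeta_c$, an element of $R[x_{ij}]$. Let $\Gamma_\lambda$ be the $R$-submodule of $R[x_{ij}]$ spanned by the monomials of all tabloids of shape $\lambda$, let $Z_\lambda(\pi)\subseteq\Gamma_\lambda$ be the submodule spanned by the monomials of the tabloids $T\not\preceq Y_\lambda(\pi)$, and let $\Gamma_\lambda(\pi):=\Gamma_\lambda/Z_\lambda(\pi)$ be the Demazure quotient. Theorem. (a) Over every commutative ring $R$, the residues of the monomials of the $\pi$-Demazure tableaux of shape $\lambda$ generate the $R$-module $\Gamma_\lambda(\pi)$. (b) Over every field of characteristic zero (for example $\mathbb C$), the residues of the monomials of the $\pi$-Demazure tableaux of shape $\lambda$, indexed by these tableaux, form a basis of the vector space $\Gamma_\lambda(\pi)$.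 -/

import Mathlib

noncomputable section

/- Conventions: the set `[n] = {1, …, n}` is modelled by `Fin n` (so values, rows and columns are
numbered from `0`).  All order comparisons are unaffected by this shift. -/

/-- An `n`-partition: an `n`-tuple `λ₁ ≥ λ₂ ≥ ⋯ ≥ λₙ ≥ 0`. -/
structure NPartition (n : ℕ) where
  parts : Fin n → ℕ
  antitone_parts : Antitone parts

/-- A shape with at most `n` rows, recorded by its sequence of column lengths
`n ≥ ζ₁ ≥ ζ₂ ≥ ⋯`. -/
structure Shape (n : ℕ) where
  numCols : ℕ
  len : Fin numCols → ℕ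
  len_le : ∀ c, len c ≤ n
  antitone_len : Antitone len

/-- The shape of an `n`-partition `λ`: row `r` has `λ_r` boxes.  The number of columns is the
largest part `λ₁`, and the length of column `c` is the number of rows `r` that reach column `c`. -/
def NPartition.shape {n : ℕ} (lam : NPartition n) : Shape n where
  numCols := Finset.univ.sup lam.parts
  len c := (Finset.univ.filter fun r : Fin n => (c : ℕ) < lam.parts r).card
  len_le _ := (Finset.card_le_univ _).trans_eq (Fintype.card_fin n)
  antitone_len := by
    intro c d hcd
    refine Finset.card_le_card fun r hr => ?_
    simp only [Finset.mem_filter, Finset.mem_univ, true_and] at hr ⊢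
    exact lt_of_le_of_lt (by exact_mod_cast hcd) hr

/-- `Q(λ)`: the set of distinct column lengths that are less than `n`. -/
def Shape.lengths {n : ℕ} (s : Shape n) : Finset ℕ :=
  (Finset.univ.image s.len).filter (· < n)

theorem Shape.len_mem_or {n : ℕ} {s : Shape n} {Q : Finset ℕ} (hs : s.lengths ⊆ Q)
    (c : Fin s.numCols) : s.len c ∈ Q ∨ s.len c = n := by
  rcases (s.len_le c).lt_or_eq with h | h
  · exact Or.inl (hs (Finset.mem_filter.2
      ⟨Finset.mem_image_of_mem _ (Finset.mem_univ c), h⟩))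
  · exact Or.inr h

/-- A filling of a shape with values from `[n]`; `T c r` is the value in column `c` and row `r`.
Fillings carry the entrywise (product) order: `T ≤ U` iff `T c r ≤ U c r` at all locations. -/
abbrev Filling {n : ℕ} (s : Shape n) : Type :=
  (c : Fin s.numCols) → Fin (s.len c) → Fin n

section Tableaux

variable {n : ℕ} {s : Shape n}

/-- A tabloid: the values strictly increase down each column. -/
def IsTabloid (T : Filling s) : Prop :=
  ∀ c, StrictMono (T c)

/-- A (semistandard Young) tableau: a tabloid whose values weakly increase across each row. -/
def IsTableau (T : Filling s) : Prop :=
  IsTabloid T ∧ ∀ (c d : Fin s.numCols), c ≤ d →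
    ∀ (r : ℕ) (hc : r < s.len c) (hd : r < s.len d), T c ⟨r, hc⟩ ≤ T d ⟨r, hd⟩

end Tableaux

/-- A `Q`-chain: a chain of subsets `P₁ ⊂ P₂ ⊂ ⋯ ⊂ P_k ⊆ [n]` whose cardinalities are the elements
`q₁ < ⋯ < q_k` of `Q`.  The subset of cardinality `q ∈ Q` is written `P q`. -/
structure QChain (n : ℕ) (Q : Finset ℕ) where
  P : {q : ℕ // q ∈ Q} → Finset (Fin n)
  card_P : ∀ q, (P q).card = q.1
  strictMono_P : StrictMono P

/-- The column of length `d` of the key of a `Q`-chain: `Y(P)` for the member `P` of the chain with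
`|P| = d` if `d ∈ Q`, and `Y([n])` if `d = n`.  Here `Y(P)` lists `P` in increasing order. -/
def QChain.column {n : ℕ} {Q : Finset ℕ} (π : QChain n Q) (d : ℕ) (hd : d ∈ Q ∨ d = n) :
    Fin d → Fin n :=
  if h : d ∈ Q then
    (π.P ⟨d, h⟩).orderEmbOfFin (π.card_P ⟨d, h⟩)
  else
    (Finset.univ : Finset (Fin n)).orderEmbOfFin (by
      rw [Finset.card_univ, Fintype.card_fin]
      exact (hd.resolve_left h).symm)

/-- The `λ`-key `Y_λ(π)`: each column of length `q ∈ Q` is `Y(P q)` and each column of length `n` is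
`Y([n])`. -/
def QChain.key {n : ℕ} {Q : Finset ℕ} (π : QChain n Q) (s : Shape n) (hs : s.lengths ⊆ Q) :
    Filling s :=
  fun c => π.column (s.len c) (Shape.len_mem_or hs c)

/-! ### The scanning tableau -/

/-- Continuation of the earliest weakly increasing subsequence (of the values `val`) whose most
recent member is `cur`. -/
def ewisFrom {α : Type*} (val : α → ℕ) (cur : α) : List α → List α
  | [] => []
  | x :: xs => if val cur ≤ val x then x :: ewisFrom val x xs else ewisFrom val cur xs

/-- The earliest weakly increasing subsequence of a sequence: it starts with the first member,
and then repeatedly takes the next member whose value is at least the value last taken. -/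
def ewis {α : Type*} (val : α → ℕ) : List α → List α
  | [] => []
  | x :: xs => x :: ewisFrom val x xs

section Scanning

variable {n : ℕ} {s : Shape n}

/-- The value of `T` in column `c` and row `r`, as a natural number (`0` off the shape). -/
def entry (T : Filling s) (c : Fin s.numCols) (r : ℕ) : ℕ :=
  if h : r < s.len c then (T c ⟨r, h⟩ : ℕ) else 0

/-- Since only column bottoms get marked, the unmarked locations are the top `h j` locations of
each column `j`.  This is the bottom-most unmarked value in column `j` (used when `0 < h j`). -/
def bottomValue (T : Filling s) (h : Fin s.numCols → ℕ) (j : Fin s.numCols) : ℕ :=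
  entry T j (h j - 1)

/-- One scan, ignoring the columns to the left of column `c`: the columns, from left to right, whose
bottom-most unmarked values form the earliest weakly increasing subsequence. -/
def scanOnce (T : Filling s) (c : Fin s.numCols) (h : Fin s.numCols → ℕ) :
    List (Fin s.numCols) :=
  ewis (bottomValue T h)
    ((List.finRange s.numCols).filter fun j => decide (c ≤ j ∧ 0 < h j))

/-- The numbers of unmarked locations in each column after `i` scans from column `c`. -/
def heights (T : Filling s) (c : Fin s.numCols) : ℕ → Fin s.numCols → ℕ
  | 0 => s.len
  | i + 1 => fun j =>
      if j ∈ scanOnce T c (heights T c i) then heights T c i j - 1 else heights T c i j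

/-- The scanning tableau `S(T)`.  Column `c` is filled from bottom to top, so row `r` is filled by
the scan that has `len c - 1 - r` predecessors, with the last value of its scanning path.  (That
path is never empty, since it starts in column `c`.) -/
def scanningTableau (T : Filling s) (c : Fin s.numCols) (r : Fin (s.len c)) : ℕ :=
  match (scanOnce T c (heights T c (s.len c - 1 - r))).getLast? with
  | some j => bottomValue T (heights T c (s.len c - 1 - r)) j
  | none => 0

end Scanning

/-- A `π`-Demazure tableau of shape `λ`: a tableau `T` with `S(T) ⪯ Y_λ(π)`. -/
def IsDemazure {n : ℕ} {Q : Finset ℕ} (π : QChain n Q) (s : Shape n) (hs : s.lengths ⊆ Q)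
    (T : Filling s) : Prop :=
  IsTableau T ∧ ∀ c r, scanningTableau T c r ≤ (π.key s hs c r : ℕ)

/-! ### Tabloid monomials and the Demazure quotient -/

section Monomials

variable (R : Type*) [CommRing R] {n : ℕ}

/-- The monomial of a filling `T`: the product over the columns `c` of the `ζ_c`-initial minor, in
the generic matrix `(x_{ij})`, with rows `T c 0, T c 1, …`. -/
def tabMonomial {s : Shape n} (T : Filling s) : MvPolynomial (Fin n × Fin n) R :=
  ∏ c : Fin s.numCols, Matrix.det (Matrix.of fun i j : Fin (s.len c) =>
    (MvPolynomial.X (T c i, Fin.castLE (s.len_le c) j) : MvPolynomial (Fin n × Fin n) R))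

/-- `Γ_λ`: the linear combinations of the monomials of the tabloids of shape `λ`. -/
def Gam (s : Shape n) : Submodule R (MvPolynomial (Fin n × Fin n) R) :=
  Submodule.span R {p | ∃ T : Filling s, IsTabloid T ∧ p = tabMonomial R T}

/-- The monomial of a tabloid, as an element of `Γ_λ`. -/
def gamMonomial {s : Shape n} (T : Filling s) (hT : IsTabloid T) : Gam R s :=
  ⟨tabMonomial R T, Submodule.subset_span ⟨T, hT, rfl⟩⟩

/-- `Z_λ(π)`: the span of the monomials of the tabloids `T` with `T ⋠ Y_λ(π)`. -/
def ZSub {Q : Finset ℕ} (π : QChain n Q) (s : Shape n) (hs : s.lengths ⊆ Q) :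
    Submodule R (Gam R s) :=
  Submodule.span R {x | ∃ (T : Filling s) (hT : IsTabloid T),
    ¬ T ≤ π.key s hs ∧ x = gamMonomial R T hT}

/-- The Demazure quotient `Γ_λ(π) = Γ_λ / Z_λ(π)`. -/
abbrev DemazureQuotient {Q : Finset ℕ} (π : QChain n Q) (s : Shape n) (hs : s.lengths ⊆ Q) :
    Type _ :=
  Gam R s ⧸ ZSub R π s hs

/-- The residue in `Γ_λ(π)` of the monomial of a `π`-Demazure tableau. -/
def demazureMonomial {Q : Finset ℕ} (π : QChain n Q) (s : Shape n) (hs : s.lengths ⊆ Q)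
    (T : {T : Filling s // IsDemazure π s hs T}) : DemazureQuotient R π s hs :=
  (ZSub R π s hs).mkQ (gamMonomial R T.1 T.2.1.1)

end Monomials

end

/-! A `Q`-chain consists of initial sets of some permutation `w`, and being below the key means that
each column set is dominated by the initial set of `w` of its size. The proof is a standard monomial
theory relative to `w`, using a recursive form of the Demazure condition.

Read the columns from the last to the first. The last column `K` must be dominated by `w`; then `w`
is replaced by `down w K`, a permutation below `w` with `K` as an initial set, whose initial sets of
size at least `#K` are the sets `meet (initSet w q) K`, and the remaining columns must be standard
for it. The scans fit this recursion: reading one more column merges it into the endpoints of the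
scanning paths, and merging with `K` is adjoint to taking the meet with `K`. Both are governed by
the inequalities `cnt E x + seg K t x ≤ cnt W t` for `t ≤ x`, where `E` is the set of endpoints
before the column is read (`dom_initSet_down_iff`, `IsMerge.seqCnt_ge`, `IsMerge.seqCnt_le`). Hence
a tabloid is a Demazure tableau exactly when its columns are standard (`isStandard_iff`,
`isDemazure_iff`).

Spanning is a straightening algorithm. If an earlier column `I` is not dominated by the meet, one
such inequality fails for some `t ≤ x`. Exchanging the entries of `K` in `[t, x)` with all subsets
of `I` of the same size gives products in which either `K` has grown in colexicographic order or `I`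
is no longer dominated by `w`, so that the product lies in the submodule divided out
(`setMinor_mul_mem_span`, `listMon_mem_span`). The relations have integer coefficients, so any
commutative ring will do.

For independence, monomials are evaluated at the matrices whose column `j` vanishes below row `w j`;
the submodule divided out vanishes there. A relation on these matrices persists for every
permutation below `w` (`BruhatLE.vanishing`). Restricting to `down w I`, for a minimal last column
`I` occurring in the relation, kills all terms with another last column; the minor of `I` cancels,
and induction on the number of columns finishes (`eq_zero_of_isStandard`). -/

noncomputable section

open Finset

/-! ### Dominance of sets by counting, and the meet with a prescribed subset -/

section Counting

variable {n : ℕ}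

/-- The number of elements of `A` that are at least `t`. -/
def cnt (A : Finset (Fin n)) (t : ℕ) : ℕ := (A.filter fun a : Fin n => t ≤ (a : ℕ)).card

/-- The number of elements of `A` in the interval `[t, x)`. -/
def seg (A : Finset (Fin n)) (t x : ℕ) : ℕ := (A.filter fun a : Fin n => t ≤ (a : ℕ) ∧ (a : ℕ) < x).card

/-- Dominance of finite sets; for sets of equal size this is entrywise comparison of the sorted
lists of elements. -/
def Dom (A B : Finset (Fin n)) : Prop := ∀ t, cnt A t ≤ cnt B t

theorem seg_add_cnt (A : Finset (Fin n)) {t x : ℕ} (h : t ≤ x) :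
    seg A t x + cnt A x = cnt A t := by
  unfold seg cnt
  rw [← card_union_of_disjoint]
  · congr 1
    ext a
    simp only [mem_union, mem_filter]
    grind
  · rw [disjoint_left]
    intro a
    simp only [mem_filter]
    grind

theorem seg_self (A : Finset (Fin n)) (t : ℕ) : seg A t t = 0 := by
  unfold seg
  rw [card_eq_zero, filter_eq_empty_iff]
  intro a _
  omega

theorem cnt_of_le (A : Finset (Fin n)) {t : ℕ} (h : n ≤ t) : cnt A t = 0 := by
  unfold cnt
  rw [card_eq_zero, filter_eq_empty_iff]
  intro a _
  omega

theorem cnt_zero (A : Finset (Fin n)) : cnt A 0 = A.card := by simp [cnt]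

theorem cnt_eq_succ (A : Finset (Fin n)) (x : Fin n) :
    cnt A x = cnt A (x + 1) + if x ∈ A then 1 else 0 := by
  unfold cnt
  split_ifs with h
  · rw [← card_insert_of_notMem (a := x)]
    · congr 1
      ext a
      simp only [mem_insert, mem_filter, Fin.ext_iff]
      grind
    · simp
  · congr 1
    ext a
    simp only [mem_filter]
    have : a = x ↔ (a : ℕ) = x := Fin.ext_iff
    grind

theorem seg_succ (A : Finset (Fin n)) (x : Fin n) {t : ℕ} (h : t ≤ x) :
    seg A t (x + 1) = seg A t x + if x ∈ A then 1 else 0 := by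
  have h1 := seg_add_cnt A h
  have h2 := seg_add_cnt A (Nat.le_succ_of_le h)
  have h3 := cnt_eq_succ A x
  simp only [Nat.succ_eq_add_one] at h2
  omega

theorem seg_mono {A B : Finset (Fin n)} (h : A ⊆ B) (t x : ℕ) : seg A t x ≤ seg B t x :=
  card_le_card (filter_subset_filter _ h)

theorem cnt_mono {A B : Finset (Fin n)} (h : A ⊆ B) (t : ℕ) : cnt A t ≤ cnt B t :=
  card_le_card (filter_subset_filter _ h)

theorem cnt_injective : Function.Injective (cnt : Finset (Fin n) → ℕ → ℕ) := by
  intro A B h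
  ext x
  have h1 := cnt_eq_succ A x
  have h2 := cnt_eq_succ B x
  rw [h] at h1
  grind

theorem Dom.trans {A B C : Finset (Fin n)} (h : Dom A B) (h' : Dom B C) : Dom A C :=
  fun t => (h t).trans (h' t)

/-- The largest set, in the dominance order, that contains `K` and is dominated by `W`. -/
def meet (W K : Finset (Fin n)) : Finset (Fin n) :=
  K ∪ univ.filter fun x => ∀ t ≤ (x : ℕ), seg K t (x + 1) < seg W t (x + 1)

theorem subset_meet (W K : Finset (Fin n)) : K ⊆ meet W K := subset_union_left

theorem meet_mono {W W' : Finset (Fin n)} (h : W ⊆ W') (K : Finset (Fin n)) :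
    meet W K ⊆ meet W' K := by
  refine union_subset_union_right fun x => ?_
  simp only [mem_filter, mem_univ, true_and]
  exact fun hx t ht => (hx t ht).trans_le (seg_mono h _ _)

/-- Together the two parts say that `cnt (meet W K) x` is the minimum of `cnt W t - seg K t x` over
`t ≤ x`. The minimum is computed by recursion from `x + 1` down to `x`: an element `x` outside `K`
joins the meet exactly when the minimum at `x + 1` is attained only at the new index `t = x + 1`. -/
theorem cnt_meet {W K : Finset (Fin n)} (h : Dom K W) (x : ℕ) :
    (∀ t ≤ x, cnt (meet W K) x + seg K t x ≤ cnt W t) ∧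
      ∃ t ≤ x, cnt W t ≤ cnt (meet W K) x + seg K t x := by
  by_cases hx : n ≤ x
  · refine ⟨fun t ht => ?_, x, le_rfl, ?_⟩
    · have := seg_add_cnt K ht
      have := h t
      rw [cnt_of_le _ hx] at *
      omega
    · simp [cnt_of_le _ hx]
  · push Not at hx
    obtain ⟨h1, t0, ht0, h2⟩ := cnt_meet h (x + 1)
    have e1 := cnt_eq_succ (meet W K) ⟨x, hx⟩
    have e2 := fun t (ht : t ≤ x) => seg_succ K ⟨x, hx⟩ ht
    have e3 := cnt_eq_succ W ⟨x, hx⟩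
    have e4 := fun t (ht : t ≤ x) => seg_add_cnt W (Nat.le_succ_of_le ht)
    have hsub : (⟨x, hx⟩ : Fin n) ∈ K → (⟨x, hx⟩ : Fin n) ∈ meet W K := fun h => subset_meet W K h
    have hmem : (⟨x, hx⟩ : Fin n) ∈ meet W K ↔ (⟨x, hx⟩ : Fin n) ∈ K ∨
        ∀ t ≤ x, seg K t (x + 1) < seg W t (x + 1) := by simp [meet]
    simp only [Nat.succ_eq_add_one] at *
    constructor
    · intro t ht
      have a1 := h1 t (by omega)
      have a2 := h1 (x + 1) le_rfl
      rw [seg_self] at a2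
      have a3 := e2 t ht
      have a4 := e4 t ht
      grind
    · rcases Nat.lt_or_ge x t0 with hlt | hle
      · obtain rfl : t0 = x + 1 := by omega
        rw [seg_self] at h2
        by_cases hm : (⟨x, hx⟩ : Fin n) ∈ meet W K
        · refine ⟨x, le_rfl, ?_⟩
          grind
        · have : ∃ t ≤ x, seg W t (x + 1) ≤ seg K t (x + 1) := by grind
          obtain ⟨t, ht, h3⟩ := this
          refine ⟨t, ht, ?_⟩
          have a3 := e2 t ht
          have a4 := e4 t ht
          grind
      · refine ⟨t0, hle, ?_⟩
        have a3 := e2 t0 hle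
        grind
termination_by n - x

theorem dom_meet {W K : Finset (Fin n)} (h : Dom K W) : Dom (meet W K) W := fun t => by
  have := (cnt_meet h t).1 t le_rfl
  omega

theorem card_meet {W K : Finset (Fin n)} (h : Dom K W) : (meet W K).card = W.card := by
  obtain ⟨h1, t, ht, h2⟩ := cnt_meet h 0
  have h1 := h1 0 le_rfl
  obtain rfl : t = 0 := by omega
  rw [seg_self, cnt_zero, cnt_zero] at *
  omega

end Counting

/-! ### Chains of initial sets and the Bruhat order -/

section Flags

variable {n : ℕ}

/-- The set of the first `q` values of the permutation `w`. -/
def initSet (w : Equiv.Perm (Fin n)) (q : ℕ) : Finset (Fin n) :=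
  (univ.filter fun j : Fin n => (j : ℕ) < q).map w.toEmbedding

theorem mem_initSet {w : Equiv.Perm (Fin n)} {q : ℕ} {x : Fin n} :
    x ∈ initSet w q ↔ (w.symm x : ℕ) < q := by
  simp [initSet, mem_map_equiv]

theorem apply_mem_initSet {w : Equiv.Perm (Fin n)} {q : ℕ} {j : Fin n} :
    w j ∈ initSet w q ↔ (j : ℕ) < q := by
  simp [mem_initSet]

theorem initSet_mono (w : Equiv.Perm (Fin n)) : Monotone (initSet w) := by
  intro q q' h x
  simp only [mem_initSet]
  omega

theorem card_initSet (w : Equiv.Perm (Fin n)) {q : ℕ} (h : q ≤ n) : (initSet w q).card = q := by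
  rw [initSet, card_map, Fin.card_filter_val_lt, min_eq_right h]

theorem mem_iff_lt_card_of_isLowerSet {L : Finset (Fin n)} (h : IsLowerSet (L : Set (Fin n)))
    (j : Fin n) : j ∈ L ↔ (j : ℕ) < L.card := by
  constructor
  · intro hj
    have : Iic j ⊆ L := fun i hi => h (mem_Iic.1 hi) hj
    have := card_le_card this
    rw [Fin.card_Iic] at this
    omega
  · intro hj
    by_contra hn
    have : L ⊆ Iio j := fun i hi => by
      rw [mem_Iio]
      by_contra hij
      exact hn (h (not_lt.1 hij) hi)
    have := card_le_card this
    rw [Fin.card_Iio] at this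
    omega

/-- Every chain of sets extends to the chain of initial sets of a permutation. -/
theorem exists_perm_initSet (S : ℕ → Finset (Fin n)) (hS : Monotone S) :
    ∃ v : Equiv.Perm (Fin n), ∀ q ≤ n, (S q).card = q → initSet v q = S q := by
  -- The index at which `x` enters the chain, or `n + 1` if it has not entered by `n`. Sorting the
  -- elements by this index gives the permutation.
  let f : Fin n → ℕ := fun x => ((range (n + 1)).filter fun q => x ∉ S q).card
  have hf : ∀ q ≤ n, ∀ x, x ∈ S q ↔ f x ≤ q := by
    intro q hq x
    constructor
    · intro hx
      calc f x ≤ (range q).card := by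
            refine card_le_card fun p hp => ?_
            rw [mem_filter] at hp
            rw [mem_range]
            by_contra hpq
            exact hp.2 (hS (not_lt.1 hpq) hx)
        _ = q := card_range q
    · intro hx
      by_contra hn
      have : range (q + 1) ⊆ (range (n + 1)).filter fun q => x ∉ S q := by
        intro p hp
        rw [mem_range] at hp
        rw [mem_filter, mem_range]
        exact ⟨by omega, fun h => hn (hS (by omega) h)⟩
      have := card_le_card this
      rw [card_range] at this
      have : q + 1 ≤ f x := this
      omega
  refine ⟨Tuple.sort f, fun q hq hc => ?_⟩
  have hm := Tuple.monotone_sort f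
  let L : Finset (Fin n) := (S q).map (Tuple.sort f).symm.toEmbedding
  have hL : ∀ j, j ∈ L ↔ f (Tuple.sort f j) ≤ q := by
    intro j
    rw [← hf q hq]
    simp [L, mem_map_equiv]
  have hlow : IsLowerSet (L : Set (Fin n)) := by
    intro i j hij hi
    rw [mem_coe, hL] at *
    exact (hm hij).trans hi
  ext x
  rw [mem_initSet, hf q hq]
  have := mem_iff_lt_card_of_isLowerSet hlow ((Tuple.sort f).symm x)
  rw [hL, card_map, hc] at this
  simpa using this.symm

theorem cnt_initSet (w : Equiv.Perm (Fin n)) (q t : ℕ) :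
    cnt (initSet w q) t = (univ.filter fun j : Fin n => (j : ℕ) < q ∧ t ≤ (w j : ℕ)).card := by
  rw [cnt, initSet, filter_map, card_map, filter_filter]
  rfl

/-- Bruhat order on permutations, by comparison of initial sets. -/
def BruhatLE (v w : Equiv.Perm (Fin n)) : Prop := ∀ q ≤ n, Dom (initSet v q) (initSet w q)

/-- Only the initial sets of size `q` with `a < q ≤ b` change, and in them `w b` replaces `w a`. -/
theorem cnt_initSet_mul_swap (w : Equiv.Perm (Fin n)) {a b : Fin n} (hab : a < b)
    (q t : ℕ) : ((q ≤ a ∨ b < q) → cnt (initSet (w * Equiv.swap a b) q) t = cnt (initSet w q) t) ∧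
      (a < q → q ≤ b → cnt (initSet (w * Equiv.swap a b) q) t + (if t ≤ w a then 1 else 0) =
        cnt (initSet w q) t + if t ≤ w b then 1 else 0) := by
  have key : ∀ u : Equiv.Perm (Fin n), cnt (initSet u q) t =
      ∑ j : Fin n, if ((j : ℕ) < q ∧ t ≤ (u j : ℕ)) then 1 else 0 := by
    intro u
    rw [cnt_initSet, card_filter]
  have hne : a ≠ b := hab.ne
  have split : ∀ g : Fin n → ℕ, ∑ j, g j = g a + (g b + ∑ j ∈ (univ.erase a).erase b, g j) := by
    intro g
    rw [add_sum_erase _ _ (by simp [hne.symm]), add_sum_erase _ _ (mem_univ _)]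
  rw [key, key, split, split (fun j => if ((j : ℕ) < q ∧ t ≤ (w j : ℕ)) then 1 else 0)]
  have e : ∑ j ∈ (univ.erase a).erase b,
        (if ((j : ℕ) < q ∧ t ≤ ((w * Equiv.swap a b) j : ℕ)) then 1 else 0) =
      ∑ j ∈ (univ.erase a).erase b, if ((j : ℕ) < q ∧ t ≤ (w j : ℕ)) then 1 else 0 := by
    refine sum_congr rfl fun j hj => ?_
    simp only [mem_erase] at hj
    rw [Equiv.Perm.mul_apply, Equiv.swap_apply_of_ne_of_ne hj.2.1 hj.1]
  rw [e]
  simp only [Equiv.Perm.mul_apply, Equiv.swap_apply_left, Equiv.swap_apply_right]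
  have : (a : ℕ) < b := hab
  constructor
  · intro h
    have h1 : ((a : ℕ) < q ↔ (b : ℕ) < q) := by omega
    simp only [h1]
    omega
  · intro h1 h2
    have h3 : ¬ (b : ℕ) < q := by omega
    simp only [h1, h3, true_and, false_and, if_false]
    omega

/-- Take `a` to be the first place where `v` and `w` differ, and `b` the first later place with `v a
≤ w b < w a`. Minimality of `b` leaves enough room for the transposition to stay above `v`. -/
theorem BruhatLE.exists_swap {v w : Equiv.Perm (Fin n)} (h : BruhatLE v w) (hne : v ≠ w) :
    ∃ a b : Fin n, a < b ∧ w b < w a ∧ BruhatLE v (w * Equiv.swap a b) := by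
  have hex : ∃ a, v a ≠ w a := by
    by_contra hn
    push Not at hn
    exact hne (Equiv.ext hn)
  let D := univ.filter fun a => v a ≠ w a
  have hD : D.Nonempty := by
    obtain ⟨a, ha⟩ := hex
    exact ⟨a, by simp [D, ha]⟩
  set a := D.min' hD with ha
  have haD : v a ≠ w a := (mem_filter.1 (D.min'_mem hD)).2
  have hlt : ∀ j < a, v j = w j := by
    intro j hj
    by_contra hn
    exact absurd (D.min'_le j (by simp [D, hn])) (not_le.2 hj)
  -- The sets of the first `a + 1` values differ only in `v a` and `w a`; they are compared at the
  -- threshold `v a`.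
  have hva : v a < w a := by
    refine lt_of_le_of_ne ?_ haD
    have h1 := h (a + 1) (by omega) (v a)
    rw [cnt_initSet, cnt_initSet] at h1
    by_contra hn
    push Not at hn
    have : (univ.filter fun j : Fin n => (j : ℕ) < a + 1 ∧ (v a : ℕ) ≤ w j) ⊂
        univ.filter fun j : Fin n => (j : ℕ) < a + 1 ∧ (v a : ℕ) ≤ v j := by
      rw [ssubset_iff_of_subset]
      · refine ⟨a, by simp, ?_⟩
        simp only [mem_filter, mem_univ, true_and, not_and, not_le]
        exact fun _ => hn
      · intro j
        simp only [mem_filter, mem_univ, true_and]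
        rintro ⟨hj, hj'⟩
        refine ⟨hj, ?_⟩
        rcases eq_or_ne j a with rfl | hja
        · exact le_rfl
        · rw [hlt j (lt_of_le_of_ne (by rw [Fin.le_def]; omega) hja)]
          exact hj'
    exact absurd (card_lt_card this) (not_lt.2 h1)
  let E := univ.filter fun b => a < b ∧ v a ≤ w b ∧ w b < w a
  have hE : E.Nonempty := by
    refine ⟨w.symm (v a), ?_⟩
    simp only [E, mem_filter, mem_univ, true_and, Equiv.apply_symm_apply, le_refl, hva, and_true]
    by_contra hn
    rcases (not_lt.1 hn).lt_or_eq with h1 | h1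
    · have := hlt _ h1
      rw [Equiv.apply_symm_apply] at this
      exact h1.ne (v.injective this)
    · rw [Equiv.symm_apply_eq] at h1
      exact haD h1
  set b := E.min' hE with hb
  obtain ⟨hab, hb1, hb2⟩ : a < b ∧ v a ≤ w b ∧ w b < w a := by
    exact (mem_filter.1 (E.min'_mem hE)).2
  have hbmin : ∀ j, a < j → j < b → v a ≤ w j → w a ≤ w j := by
    intro j h1 h2 h3
    by_contra hn
    exact absurd (E.min'_le j (by simp [E, h1, h3, not_le.1 hn])) (not_le.2 h2)
  refine ⟨a, b, hab, hb2, fun q hq t => ?_⟩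
  obtain ⟨c1, c2⟩ := cnt_initSet_mul_swap w hab q t
  by_cases hqab : q ≤ a ∨ (b : ℕ) < q
  · rw [c1 hqab]
    exact h q hq t
  push Not at hqab
  specialize c2 hqab.1 hqab.2
  have hvw := h q hq t
  by_cases ht : t ≤ w a
  swap
  · rw [if_neg ht] at c2
    omega
  by_cases ht' : t ≤ w b
  · rw [if_pos ht, if_pos ht'] at c2
    omega
  rw [if_pos ht, if_neg ht'] at c2
  push Not at ht'
  have hvt : (v a : ℕ) ≤ t := by
    have : (v a : ℕ) ≤ w b := hb1
    omega
  have h1 := h q hq (v a)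
  have e1 := seg_add_cnt (initSet v q) hvt
  have e2 := seg_add_cnt (initSet w q) hvt
  -- Here `w b < t ≤ w a` and `a < q ≤ b`, so the swap costs one element above `t`. By minimality of
  -- `b`, the elements of `initSet w q` in `[v a, t)` come from places before `a`, where `v` and `w`
  -- agree, while `v` has `v a` in addition. Comparing `v` with `w` at the threshold `v a` therefore
  -- leaves a strict inequality at `t`.
  have e3 : seg (initSet w q) (v a) t < seg (initSet v q) (v a) t := by
    refine card_lt_card ?_
    rw [ssubset_iff_of_subset]
    · refine ⟨v a, ?_, ?_⟩
      · simp only [mem_filter, apply_mem_initSet]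
        have : (v a : ℕ) ≤ w b := hb1
        omega
      · simp only [mem_filter, mem_initSet]
        rintro ⟨h3, -, -⟩
        rcases lt_trichotomy (w.symm (v a)) a with h4 | h4 | h4
        · have := hlt _ h4
          rw [Equiv.apply_symm_apply] at this
          exact h4.ne (v.injective this)
        · rw [Equiv.symm_apply_eq] at h4
          exact haD h4
        · have := hbmin _ h4 (by rw [Fin.lt_def]; omega) (by simp)
          rw [Equiv.apply_symm_apply] at this
          exact absurd hva (not_lt.2 this)
    · intro x
      obtain ⟨j, rfl⟩ := w.surjective x
      simp only [mem_filter, apply_mem_initSet]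
      rintro ⟨h3, h4, h5⟩
      refine ⟨?_, h4, h5⟩
      rcases lt_trichotomy j a with h6 | h6 | h6
      · rw [← hlt j h6, apply_mem_initSet]
        exact h3
      · subst h6
        omega
      · have : (w a : ℕ) ≤ w j := hbmin j h6 (by rw [Fin.lt_def]; omega) h4
        omega
  omega

/-- Each transposition from `exists_swap` strictly lowers the sum of all counts of the initial sets,
so finitely many lead from `w` down to `v`. -/
theorem BruhatLE.induction {P : Equiv.Perm (Fin n) → Prop}
    (step : ∀ (w : Equiv.Perm (Fin n)) (a b : Fin n), a < b → w b < w a → P w →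
      P (w * Equiv.swap a b))
    {v w : Equiv.Perm (Fin n)} (h : BruhatLE v w) (hw : P w) : P v := by
  induction hm : ∑ q ∈ range (n + 1), ∑ t ∈ range n, cnt (initSet w q) t
    using Nat.strong_induction_on generalizing w with
  | _ m ih =>
  by_cases hvw : v = w
  · rwa [hvw]
  obtain ⟨a, b, hab, hw', hle⟩ := h.exists_swap hvw
  refine ih _ ?_ hle (step w a b hab hw' hw) rfl
  have hab' : (a : ℕ) < b := hab
  have hw'' : (w b : ℕ) < w a := hw'
  have hcmp : ∀ q t, cnt (initSet (w * Equiv.swap a b) q) t ≤ cnt (initSet w q) t := by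
    intro q t
    obtain ⟨c1, c2⟩ := cnt_initSet_mul_swap w hab q t
    by_cases hq : q ≤ a ∨ (b : ℕ) < q
    · exact (c1 hq).le
    · push Not at hq
      have := c2 hq.1 hq.2
      split_ifs at this <;> omega
  rw [← hm]
  refine sum_lt_sum (fun q _ => sum_le_sum fun t _ => hcmp q t) ⟨a + 1, by simp, ?_⟩
  refine sum_lt_sum (fun t _ => hcmp _ t) ⟨w a, by simp, ?_⟩
  have := (cnt_initSet_mul_swap w hab (a + 1) (w a)).2 (by omega) (by omega)
  rw [if_pos le_rfl, if_neg (by omega)] at this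
  omega

/-- The largest permutation below `w` whose first `#K` values form the set `K`, as far as its
initial sets of size at least `#K` are concerned. -/
theorem exists_down (w : Equiv.Perm (Fin n)) (K : Finset (Fin n))
    (hK : Dom K (initSet w K.card)) :
    ∃ v : Equiv.Perm (Fin n), BruhatLE v w ∧
      ∀ q, K.card ≤ q → q ≤ n → initSet v q = meet (initSet w q) K := by
  have hKn : K.card ≤ n := by simpa using card_le_univ K
  have hdom : ∀ q, K.card ≤ q → Dom K (initSet w q) := fun q hq =>
    hK.trans fun t => cnt_mono (initSet_mono w hq) t
  have hcard : ∀ q, K.card ≤ q → q ≤ n → (meet (initSet w q) K).card = q := fun q hq hqn => by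
    rw [card_meet (hdom q hq), card_initSet w hqn]
  -- Below size `#K` the chain consists of the smallest elements of `K`; these keep it below `w`.
  let low : ℕ → Finset (Fin n) := fun q =>
    (univ.filter fun j : Fin K.card => (j : ℕ) < q).map (K.orderEmbOfFin rfl).toEmbedding
  have hlowK : ∀ q, low q ⊆ K := by
    intro q x hx
    obtain ⟨j, -, rfl⟩ := mem_map.1 hx
    exact K.orderEmbOfFin_mem rfl j
  have hlowcard : ∀ q ≤ K.card, (low q).card = q := fun q hq => by
    rw [card_map, Fin.card_filter_val_lt, min_eq_right hq]
  let S : ℕ → Finset (Fin n) := fun q => if q < K.card then low q else meet (initSet w q) K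
  have hS : Monotone S := by
    intro p q hpq
    by_cases hp : p < K.card <;> by_cases hq : q < K.card
    · simp only [S, hp, hq, if_true]
      refine map_subset_map.2 fun j => ?_
      simp only [mem_filter, mem_univ, true_and]
      omega
    · simp only [S, hp, hq, if_true, if_false]
      exact (hlowK p).trans (subset_meet _ _)
    · omega
    · simp only [S, hp, hq, if_false]
      exact meet_mono (initSet_mono w hpq) K
  obtain ⟨v, hv⟩ := exists_perm_initSet S hS
  have hv1 : ∀ q, K.card ≤ q → q ≤ n → initSet v q = meet (initSet w q) K := by
    intro q hq hqn
    rw [hv q hqn] <;> simp only [S, not_lt.2 hq, if_false]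
    exact hcard q hq hqn
  refine ⟨v, fun q hqn => ?_, hv1⟩
  by_cases hq : q < K.card
  swap
  · rw [hv1 q (not_lt.1 hq) hqn]
    exact dom_meet (hdom q (not_lt.1 hq))
  rw [hv q hqn (by simpa only [S, hq, if_true] using hlowcard q hq.le)]
  simp only [S, hq, if_true]
  intro t
  by_cases h0 : ∃ x ∈ low q, t ≤ (x : ℕ)
  swap
  · have : cnt (low q) t = 0 := by
      rw [cnt, card_eq_zero, filter_eq_empty_iff]
      push Not at h0
      exact fun x hx => not_le.2 (h0 x hx)
    omega
  obtain ⟨x, hx, htx⟩ := h0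
  obtain ⟨j, hj, rfl⟩ := mem_map.1 hx
  -- Since `low q` reaches `t`, it contains every element of `K` smaller than `t`. Passing to
  -- complementary counts reduces the claim to dominance at size `#K`.
  have hsub : seg K 0 t ≤ seg (low q) 0 t := by
    refine card_le_card fun y hy => ?_
    rw [mem_filter] at hy ⊢
    refine ⟨?_, hy.2⟩
    have : y ∈ Set.range (K.orderEmbOfFin rfl) := by
      rw [range_orderEmbOfFin]
      exact hy.1
    obtain ⟨i, rfl⟩ := this
    refine mem_map.2 ⟨i, ?_, rfl⟩
    simp only [mem_filter, mem_univ, true_and] at hj ⊢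
    have : K.orderEmbOfFin rfl i < K.orderEmbOfFin rfl j := Fin.lt_def.2 (hy.2.2.trans_le htx)
    have : i < j := (K.orderEmbOfFin rfl).lt_iff_lt.1 this
    have : (i : ℕ) < j := this
    omega
  have a1 := seg_add_cnt K (Nat.zero_le t)
  have a2 := seg_add_cnt (low q) (Nat.zero_le t)
  have a3 := seg_add_cnt (initSet w q) (Nat.zero_le t)
  have a4 := seg_add_cnt (initSet w K.card) (Nat.zero_le t)
  have a5 := seg_mono (initSet_mono w hq.le) 0 t
  have a6 := hK t
  rw [cnt_zero] at a1 a2 a3 a4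
  rw [hlowcard q hq.le] at a2
  rw [card_initSet w hqn] at a3
  rw [card_initSet w hKn] at a4
  omega

/-- A permutation with initial sets `meet (initSet w q) K` for `q ≥ #K`. -/
def down (w : Equiv.Perm (Fin n)) (K : Finset (Fin n)) : Equiv.Perm (Fin n) :=
  open Classical in
  if h : Dom K (initSet w K.card) then (exists_down w K h).choose else w

theorem down_le {w : Equiv.Perm (Fin n)} {K : Finset (Fin n)}
    (h : Dom K (initSet w K.card)) : BruhatLE (down w K) w := by
  rw [down, dif_pos h]
  exact (exists_down w K h).choose_spec.1

theorem initSet_down {w : Equiv.Perm (Fin n)} {K : Finset (Fin n)}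
    (h : Dom K (initSet w K.card)) {q : ℕ} (hq : K.card ≤ q) (hqn : q ≤ n) :
    initSet (down w K) q = meet (initSet w q) K := by
  rw [down, dif_pos h]
  exact (exists_down w K h).choose_spec.2 q hq hqn

theorem initSet_down_card {w : Equiv.Perm (Fin n)} {K : Finset (Fin n)}
    (h : Dom K (initSet w K.card)) : initSet (down w K) K.card = K := by
  have hKn : K.card ≤ n := by simpa using card_le_univ K
  have h1 := initSet_down h le_rfl hKn
  refine (eq_of_subset_of_card_le ?_ ?_).symm
  · rw [h1]
    exact subset_meet _ _
  · rw [card_initSet _ hKn]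

/-- The comparison of a set with the initial sets of `down w K`. -/
theorem dom_initSet_down_iff {w : Equiv.Perm (Fin n)} {K : Finset (Fin n)}
    (h : Dom K (initSet w K.card)) {q : ℕ} (hq : K.card ≤ q) (hqn : q ≤ n)
    (c : ℕ → ℕ) : (∀ x, c x ≤ cnt (initSet (down w K) q) x) ↔
      ∀ x, ∀ t ≤ x, c x + seg K t x ≤ cnt (initSet w q) t := by
  rw [initSet_down h hq hqn]
  have hd : Dom K (initSet w q) := h.trans fun t => cnt_mono (initSet_mono w hq) t
  refine forall_congr' fun x => ?_
  obtain ⟨h1, t, ht, h2⟩ := cnt_meet hd x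
  constructor
  · intro hx s hs
    have := h1 s hs
    omega
  · intro hx
    have := hx t ht
    omega

end Flags


/-! ### The exchange relation for products of determinants -/

section Exchange

theorem extend_update {V ι κ : Type*} [DecidableEq ι] [DecidableEq κ] (e : κ ↪ ι) (v : κ → V)
    (m : ι → V) (i : κ) (z : V) : Function.extend e (Function.update v i z) m =
      Function.update (Function.extend e v m) (e i) z := by
  ext j
  by_cases hj : ∃ k, e k = j
  · obtain ⟨k, rfl⟩ := hj
    rw [e.injective.extend_apply]
    by_cases hk : k = i
    · subst hk
      simp
    · rw [Function.update_of_ne hk, Function.update_of_ne (e.injective.ne hk),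
        e.injective.extend_apply]
  · rw [Function.extend_apply' _ _ _ hj, Function.update_of_ne, Function.extend_apply' _ _ _ hj]
    rintro rfl
    exact hj ⟨i, rfl⟩

/-- Substituting the vectors `v` for the members of the family `m` with indices in the range of
`e`, inside an alternating map. -/
def AlternatingMap.extendFrom {R V N ι κ : Type*} [CommRing R] [AddCommGroup V] [Module R V]
    [AddCommGroup N] [Module R N] (φ : V [⋀^ι]→ₗ[R] N) (m : ι → V)
    (e : κ ↪ ι) : V [⋀^κ]→ₗ[R] N where
  toFun v := φ (Function.extend e v m)
  map_update_add' v i x y := by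
    classical
    rw [extend_update, extend_update, extend_update, φ.map_update_add]
  map_update_smul' v i c x := by
    classical
    change φ _ = c • φ _
    rw [extend_update, extend_update, φ.map_update_smul]
  map_eq_zero_of_eq' v i j h hij :=
    φ.map_eq_zero_of_eq _ (by
      show Function.extend e v m (e i) = Function.extend e v m (e j)
      rw [e.injective.extend_apply, e.injective.extend_apply, h]) (e.injective.ne hij)

theorem AlternatingMap.extendFrom_apply {R V N ι κ : Type*} [CommRing R] [AddCommGroup V]
    [Module R V] [AddCommGroup N] [Module R N] (φ : V [⋀^ι]→ₗ[R] N) (m : ι → V)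
    (e : κ ↪ ι) (v : κ → V) : φ.extendFrom m e v = φ (Function.extend e v m) := rfl

theorem alternatingMap_sum_apply {R V N ι κ : Type*} [CommRing R] [AddCommGroup V]
    [Module R V] [AddCommGroup N] [Module R N] (s : Finset κ) (φ : κ → V [⋀^ι]→ₗ[R] N)
    (v : ι → V) : (∑ k ∈ s, φ k) v = ∑ k ∈ s, φ k v := by
  classical
  induction s using Finset.induction_on with
  | empty => simp
  | insert a s ha ih => rw [sum_insert ha, sum_insert ha, AlternatingMap.add_apply, ih]

/-- Increasing enumeration of a set of positions. -/
def subsetEmb {q b : ℕ} (A : {A : Finset (Fin q) // A.card = b}) : Fin b ↪ Fin q :=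
  (A.1.orderEmbOfFin A.2).toEmbedding

theorem range_subsetEmb {q b : ℕ} (A : {A : Finset (Fin q) // A.card = b}) :
    Set.range (subsetEmb A) = A.1 := range_orderEmbOfFin A.1 A.2

/-- The exchange relation for a pair of alternating forms. -/
theorem alternating_exchange {R V : Type*} [CommRing R] [AddCommGroup V] [Module R V] {q b : ℕ}
    (m : Module.Basis (Fin q) R V) (φ : V [⋀^Fin q]→ₗ[R] R) (g : V [⋀^Fin b]→ₗ[R] R)
    (v : Fin b → V) :
    φ m * g v = ∑ A : {A : Finset (Fin q) // A.card = b},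
      φ (Function.extend (subsetEmb A) v m) * g (m ∘ subsetEmb A) := by
  -- Both sides are alternating in `v`, so it suffices to insert distinct basis vectors `m (a i)`.
  -- Only the set `A` of the indices `a i` contributes: for any other `A`, some `m (a i)` with `a i`
  -- outside `A` occurs twice in `φ`.
  have key : φ m • g = ∑ A : {A : Finset (Fin q) // A.card = b},
      g (m ∘ subsetEmb A) • φ.extendFrom m (subsetEmb A) := by
    refine m.ext_alternating fun a ha => ?_
    let A₀ : {A : Finset (Fin q) // A.card = b} :=
      ⟨univ.map ⟨a, ha⟩, by rw [card_map, card_univ, Fintype.card_fin]⟩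
    have hA₀ : Set.range (subsetEmb A₀) = Set.range a := by
      rw [range_subsetEmb]
      simp [A₀]
    rw [alternatingMap_sum_apply, sum_eq_single A₀]
    · have hex : ∀ i, ∃ j, subsetEmb A₀ j = a i := fun i => by
        have : a i ∈ Set.range (subsetEmb A₀) := hA₀ ▸ ⟨i, rfl⟩
        exact this
      choose s hs using hex
      have hsinj : Function.Injective s := fun i j hij => ha (by rw [← hs, ← hs, hij])
      let σ : Equiv.Perm (Fin b) := Equiv.ofBijective s (Finite.injective_iff_bijective.1 hsinj)
      have hσ : (fun i => m (a i)) = (m ∘ subsetEmb A₀) ∘ σ := by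
        ext i
        simp [σ, hs]
      rw [hσ]
      have hm : Function.extend (subsetEmb A₀) (m ∘ subsetEmb A₀) m = m := by
        ext j
        by_cases hj : ∃ k, subsetEmb A₀ k = j
        · obtain ⟨k, rfl⟩ := hj
          rw [(subsetEmb A₀).injective.extend_apply]
          rfl
        · rw [Function.extend_apply' _ _ _ hj]
      simp only [AlternatingMap.smul_apply, AlternatingMap.map_perm, AlternatingMap.extendFrom_apply,
        hm, smul_eq_mul]
      simp only [Units.smul_def, zsmul_eq_mul]
      ring
    · intro A _ hA
      have : ∃ i, a i ∉ A.1 := by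
        by_contra hn
        push Not at hn
        refine hA (Subtype.ext (eq_of_subset_of_card_le ?_ ?_).symm)
        · intro x hx
          obtain ⟨i, -, rfl⟩ := mem_map.1 hx
          exact hn i
        · rw [A.2, A₀.2]
      obtain ⟨i, hi⟩ := this
      have hi' : ¬ ∃ k, subsetEmb A k = a i := fun h => hi (by
        have : a i ∈ Set.range (subsetEmb A) := h
        rwa [range_subsetEmb] at this)
      rw [AlternatingMap.smul_apply, AlternatingMap.extendFrom_apply,
        φ.map_eq_zero_of_eq _ (i := subsetEmb A i) (j := a i), smul_zero]
      · rw [(subsetEmb A).injective.extend_apply, Function.extend_apply' _ _ _ hi']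
      · exact fun h => hi' ⟨i, h⟩
    · simp
  have := congrArg (fun f => f v) key
  simpa [alternatingMap_sum_apply, AlternatingMap.extendFrom_apply, mul_comm] using this

/-- The determinant of the matrix formed by the first columns of the given rows. -/
def rowDet {S : Type*} [CommRing S] {p q : ℕ} (h : p ≤ q) (v : Fin p → Fin q → S) : S :=
  Matrix.det (Matrix.of fun i j => v i (Fin.castLE h j))

theorem map_rowDet {S S' : Type*} [CommRing S] [CommRing S'] (f : S →+* S') {p q : ℕ} (h : p ≤ q)
    (v : Fin p → Fin q → S) : f (rowDet h v) = rowDet h fun i j => f (v i j) := by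
  rw [rowDet, RingHom.map_det]
  rfl

/-- `rowDet` as an alternating map. -/
def rowDetAlt (S : Type*) [CommRing S] {p q : ℕ} (h : p ≤ q) : (Fin q → S) [⋀^Fin p]→ₗ[S] S :=
  Matrix.detRowAlternating.compLinearMap (LinearMap.funLeft S S (Fin.castLE h))

theorem rowDetAlt_apply {S : Type*} [CommRing S] {p q : ℕ} (h : p ≤ q) (v : Fin p → Fin q → S) :
    rowDetAlt S h v = rowDet h v := rfl

theorem map_rowDet_extend {S S' : Type*} [CommRing S] [CommRing S'] (f : S →+* S') {p q b : ℕ}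
    (h : p ≤ q) (e : Fin b ↪ Fin p) (u : Fin b → Fin q → S) (v : Fin p → Fin q → S) :
    f (rowDet h (Function.extend e u v)) =
      rowDet h (Function.extend e (fun i j => f (u i j)) fun i j => f (v i j)) := by
  rw [map_rowDet]
  congr 1
  ext i j
  by_cases hi : ∃ k, e k = i
  · obtain ⟨k, rfl⟩ := hi
    rw [e.injective.extend_apply, e.injective.extend_apply]
  · rw [Function.extend_apply' _ _ _ hi, Function.extend_apply' _ _ _ hi]

/-- If `M` is invertible over a field, its rows form a basis and `alternating_exchange` applies. The
identity then holds for generic matrices over `ℤ`, inside the fraction field of the polynomial ring,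
and specialises to every commutative ring. -/
theorem rowDet_exchange {S : Type*} [CommRing S] {p q b : ℕ} (h : p ≤ q) (e : Fin b ↪ Fin p)
    (M : Fin q → Fin q → S) (N : Fin p → Fin q → S) :
    rowDet le_rfl M * rowDet h N = ∑ A : {A : Finset (Fin q) // A.card = b},
      rowDet le_rfl (Function.extend (subsetEmb A) (N ∘ e) M) *
        rowDet h (Function.extend e (M ∘ subsetEmb A) N) := by
  -- the case of an invertible matrix over a field
  have hfield : ∀ (F : Type) [Field F] (M : Fin q → Fin q → F) (N : Fin p → Fin q → F),
      rowDet le_rfl M ≠ 0 → rowDet le_rfl M * rowDet h N =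
        ∑ A : {A : Finset (Fin q) // A.card = b},
          rowDet le_rfl (Function.extend (subsetEmb A) (N ∘ e) M) *
            rowDet h (Function.extend e (M ∘ subsetEmb A) N) := by
    intro F _ M N hM
    have hli : LinearIndependent F M := by
      have : IsUnit (Matrix.of M) := by
        rw [Matrix.isUnit_iff_isUnit_det]
        exact isUnit_iff_ne_zero.2 hM
      exact Matrix.linearIndependent_rows_of_isUnit this
    classical
    let m : Module.Basis (Fin q) F (Fin q → F) :=

      basisOfPiSpaceOfLinearIndependent hli
    have hm : ⇑m = M := coe_basisOfPiSpaceOfLinearIndependent hli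
    have := alternating_exchange m (rowDetAlt F le_rfl) ((rowDetAlt F h).extendFrom N e) (N ∘ e)
    simp only [hm, AlternatingMap.extendFrom_apply, rowDetAlt_apply] at this
    convert this using 3
    ext i
    by_cases hi : ∃ k, e k = i
    · obtain ⟨k, rfl⟩ := hi
      rw [e.injective.extend_apply]
      rfl
    · rw [Function.extend_apply' _ _ _ hi]
  -- the generic matrices
  let P := MvPolynomial ((Fin q ⊕ Fin p) × Fin q) ℤ
  let M₀ : Fin q → Fin q → P := fun i j => MvPolynomial.X (Sum.inl i, j)
  let N₀ : Fin p → Fin q → P := fun i j => MvPolynomial.X (Sum.inr i, j)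
  have hgen : rowDet le_rfl M₀ * rowDet h N₀ = ∑ A : {A : Finset (Fin q) // A.card = b},
      rowDet le_rfl (Function.extend (subsetEmb A) (N₀ ∘ e) M₀) *
        rowDet h (Function.extend e (M₀ ∘ subsetEmb A) N₀) := by
    apply FaithfulSMul.algebraMap_injective P (FractionRing P)
    rw [map_mul, map_rowDet, map_rowDet, map_sum]
    simp only [map_mul, map_rowDet_extend]
    refine hfield (FractionRing P) _ _ ?_
    rw [← map_rowDet, Ne, FaithfulSMul.algebraMap_eq_zero_iff]
    intro h0
    -- The generic determinant is nonzero because it takes the value `1` at the identity matrix.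
    have := congrArg (MvPolynomial.aeval (R := ℤ)
      (fun x => Sum.elim (fun i => if i = x.2 then (1 : ℤ) else 0) (fun _ => 0) x.1)) h0
    rw [map_zero] at this
    rw [← AlgHom.coe_toRingHom, map_rowDet] at this
    simp only [M₀, AlgHom.coe_toRingHom, MvPolynomial.aeval_X, Sum.elim_inl] at this
    have h1 : rowDet le_rfl (fun i j : Fin q => if i = j then (1 : ℤ) else 0) = 1 := by
      rw [rowDet]
      convert Matrix.det_one (n := Fin q) (R := ℤ) using 2
      ext i j
      simp [Matrix.one_apply]
    rw [h1] at this
    exact one_ne_zero this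
  have := congrArg (MvPolynomial.aeval (R := ℤ)
      (fun x => Sum.elim (fun i => M i x.2) (fun i => N i x.2) x.1)) hgen
  rw [← AlgHom.coe_toRingHom, map_mul, map_rowDet, map_rowDet, map_sum] at this
  simp only [map_mul, map_rowDet_extend] at this
  simp only [M₀, N₀, AlgHom.coe_toRingHom, MvPolynomial.aeval_X, Sum.elim_inl, Sum.elim_inr,
    Function.comp_apply] at this
  exact this

end Exchange


/-! ### Initial minors and the straightening of a product of two minors -/

section Minors

variable {n : ℕ} {S : Type*} [CommRing S]

/-- The initial minor of `X` with rows `f 0, f 1, …`. -/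
def minor (X : Matrix (Fin n) (Fin n) S) {q : ℕ} (hq : q ≤ n) (f : Fin q → Fin n) : S :=
  Matrix.det (Matrix.of fun i j => X (f i) (Fin.castLE hq j))

theorem card_le_size (I : Finset (Fin n)) : I.card ≤ n := by simpa using card_le_univ I

/-- The initial minor of `X` with row set `I`. -/
def setMinor (X : Matrix (Fin n) (Fin n) S) (I : Finset (Fin n)) : S :=
  minor X (card_le_size I) (I.orderEmbOfFin rfl)

theorem minor_orderEmbOfFin (X : Matrix (Fin n) (Fin n) S) {q : ℕ} (hq : q ≤ n)
    {I : Finset (Fin n)} (h : I.card = q) : minor X hq (I.orderEmbOfFin h) = setMinor X I := by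
  subst h
  rfl

theorem minor_of_strictMono (X : Matrix (Fin n) (Fin n) S) {q : ℕ} (hq : q ≤ n)
    {f : Fin q → Fin n} (hf : StrictMono f) : minor X hq f = setMinor X (univ.image f) := by
  have h : (univ.image f).card = q := by
    rw [card_image_of_injective _ hf.injective, card_univ, Fintype.card_fin]
  rw [← minor_orderEmbOfFin X hq h, ← orderEmbOfFin_unique h (fun x => by simp) hf]

theorem minor_of_not_injective (X : Matrix (Fin n) (Fin n) S) {q : ℕ} (hq : q ≤ n)
    {f : Fin q → Fin n} (hf : ¬ Function.Injective f) : minor X hq f = 0 := by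
  simp only [Function.Injective, not_forall] at hf
  obtain ⟨i, j, hij, hne⟩ := hf
  exact Matrix.det_zero_of_row_eq hne (by ext k; simp [hij])

theorem minor_of_injective (X : Matrix (Fin n) (Fin n) S) {q : ℕ} (hq : q ≤ n)
    {f : Fin q → Fin n} (hf : Function.Injective f) :
    ∃ ε : ℤˣ, minor X hq f = ((ε : ℤ) : S) * setMinor X (univ.image f) := by
  have h : (univ.image f).card = q := by
    rw [card_image_of_injective _ hf, card_univ, Fintype.card_fin]
  have hex : ∀ i, ∃ j, (univ.image f).orderEmbOfFin h j = f i := fun i => by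
    have : f i ∈ Set.range ((univ.image f).orderEmbOfFin h) := by
      rw [range_orderEmbOfFin]
      simp
    exact this
  choose s hs using hex
  have hsinj : Function.Injective s := fun i j hij => hf (by rw [← hs, ← hs, hij])
  let σ : Equiv.Perm (Fin q) := Equiv.ofBijective s (Finite.injective_iff_bijective.1 hsinj)
  refine ⟨Equiv.Perm.sign σ, ?_⟩
  rw [← minor_orderEmbOfFin X hq h, minor, minor, ← Matrix.det_permute]
  congr 1
  ext i j
  simp [σ, hs]

theorem minor_exchange (X : Matrix (Fin n) (Fin n) S) {p q b : ℕ} (hpq : p ≤ q) (hq : q ≤ n)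
    (i : Fin q → Fin n) (k : Fin p → Fin n) (e : Fin b ↪ Fin p) :
    minor X hq i * minor X (hpq.trans hq) k = ∑ A : {A : Finset (Fin q) // A.card = b},
      minor X hq (Function.extend (subsetEmb A) (k ∘ e) i) *
        minor X (hpq.trans hq) (Function.extend e (i ∘ subsetEmb A) k) := by
  let r : Fin n → Fin q → S := fun a j => X a (Fin.castLE hq j)
  have hext : ∀ {p b : ℕ} (e : Fin b ↪ Fin p) (u : Fin b → Fin n) (v : Fin p → Fin n),
      Function.extend e (r ∘ u) (r ∘ v) = r ∘ Function.extend e u v := by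
    intro p b e u v
    ext j
    rw [Function.comp_apply, Function.apply_extend r]
  have := rowDet_exchange hpq e (r ∘ i) (r ∘ k)
  simp only [Function.comp_assoc, hext] at this
  exact this

/-- A weight whose comparison is the colexicographic comparison of sets. -/
def colexWeight (A : Finset (Fin n)) : ℕ := ∑ a ∈ A, 2 ^ (a : ℕ)

theorem colexWeight_lt (A : Finset (Fin n)) (x : ℕ) (h : ∀ a ∈ A, (a : ℕ) < x) :
    colexWeight A < 2 ^ x := by
  have h1 : colexWeight A = ∑ a ∈ A.map Fin.valEmbedding, 2 ^ a := by
    rw [sum_map]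
    rfl
  rw [h1]
  exact Nat.geomSum_lt le_rfl fun a ha => by
    obtain ⟨b, hb, rfl⟩ := mem_map.1 ha
    exact h b hb

theorem colexWeight_le (A : Finset (Fin n)) : colexWeight A < 2 ^ n :=
  colexWeight_lt A n fun a _ => a.2

/-- If too many elements of `I` and `K` would have to lie above `t` in every set containing `K`
that dominates `I`, then the product of the minors of `I` and `K` straightens. -/
theorem setMinor_mul_mem_span (R : Type*) [CommRing R] [Algebra R S]
    (X : Matrix (Fin n) (Fin n) S) {I K W : Finset (Fin n)} (hKI : K.card ≤ I.card)
    {t x : ℕ} (htx : t ≤ x) (h : cnt W t < cnt I x + seg K t x) :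
    setMinor X I * setMinor X K ∈ Submodule.span R {y | ∃ I' K' : Finset (Fin n),
      I'.card = I.card ∧ K'.card = K.card ∧ (colexWeight K < colexWeight K' ∨ ¬ Dom I' W) ∧
        y = setMinor X I' * setMinor X K'} := by
  classical
  let i : Fin I.card → Fin n := I.orderEmbOfFin rfl
  let k : Fin K.card → Fin n := K.orderEmbOfFin rfl
  have hi : Function.Injective i := (I.orderEmbOfFin rfl).injective
  have hk : Function.Injective k := (K.orderEmbOfFin rfl).injective
  have hiI : ∀ y, y ∈ I ↔ ∃ r, i r = y := fun y => by
    have := range_orderEmbOfFin I rfl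
    rw [← mem_coe, ← this]
    rfl
  have hkK : ∀ y, y ∈ K ↔ ∃ r, k r = y := fun y => by
    have := range_orderEmbOfFin K rfl
    rw [← mem_coe, ← this]
    rfl
  -- The positions of the entries of `K` in `[t, x)`. These entries are exchanged with all subsets
  -- `A` of positions of `I` of the same size.
  let E : Finset (Fin K.card) := univ.filter fun r => t ≤ (k r : ℕ) ∧ (k r : ℕ) < x
  let e : Fin E.card ↪ Fin K.card := (E.orderEmbOfFin rfl).toEmbedding
  have he : ∀ r, (∃ b, e b = r) ↔ t ≤ (k r : ℕ) ∧ (k r : ℕ) < x := fun r => by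
    have h1 := range_orderEmbOfFin E rfl
    have h2 : r ∈ Set.range e ↔ r ∈ (E : Set (Fin K.card)) := by
      rw [← h1]
      rfl
    simpa [E] using h2
  have hE : E.map ⟨k, hk⟩ = K.filter fun a : Fin n => t ≤ (a : ℕ) ∧ (a : ℕ) < x := by
    ext y
    simp only [mem_map, mem_filter, hkK, E, mem_univ, true_and, Function.Embedding.coeFn_mk]
    constructor
    · rintro ⟨r, hr, rfl⟩
      exact ⟨⟨r, rfl⟩, hr⟩
    · rintro ⟨⟨r, rfl⟩, hr⟩
      exact ⟨r, hr, rfl⟩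
  have hx := minor_exchange X hKI (card_le_size I) i k e
  change setMinor X I * setMinor X K = _ at hx
  rw [hx]
  refine Submodule.sum_mem _ fun A _ => ?_
  set f := Function.extend (subsetEmb A) (k ∘ e) i with hf
  set g := Function.extend e (i ∘ subsetEmb A) k with hg
  by_cases hfi : Function.Injective f
  swap
  · rw [minor_of_not_injective X _ hfi, zero_mul]
    exact zero_mem _
  by_cases hgi : Function.Injective g
  swap
  · rw [minor_of_not_injective X _ hgi, mul_zero]
    exact zero_mem _
  obtain ⟨ε, hε⟩ := minor_of_injective X (card_le_size I) hfi
  obtain ⟨ε', hε'⟩ := minor_of_injective X (card_le_size K) hgi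
  rw [hε, hε']
  have hsm : ((ε : ℤ) : S) * setMinor X (univ.image f) * (((ε' : ℤ) : S) * setMinor X (univ.image g))
      = (((ε : ℤ) * (ε' : ℤ) : ℤ) : R) • (setMinor X (univ.image f) * setMinor X (univ.image g)) := by
    rw [Algebra.smul_def, map_intCast]
    push_cast
    ring
  rw [hsm]
  refine Submodule.smul_mem _ _ (Submodule.subset_span ⟨_, _, ?_, ?_, ?_, rfl⟩)
  · rw [card_image_of_injective _ hfi, card_univ, Fintype.card_fin]
  · rw [card_image_of_injective _ hgi, card_univ, Fintype.card_fin]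
  have hA : ∀ r, (∃ b, subsetEmb A b = r) ↔ r ∈ A.1 := fun r => by
    have := range_subsetEmb A
    rw [← mem_coe, ← this]
    rfl
  have hgk : ∀ r, ¬ (t ≤ (k r : ℕ) ∧ (k r : ℕ) < x) → g r = k r := fun r hr => by
    rw [hg, Function.extend_apply' _ _ _ (by rwa [he])]
  have hfi' : ∀ r, r ∉ A.1 → f r = i r := fun r hr => by
    rw [hf, Function.extend_apply' _ _ _ (by rwa [hA])]
  -- If an entry at least `x` moves from `I` to `K`, then `K` gains at least `2 ^ x` in weight and
  -- loses less than that. Otherwise `I` keeps all its entries at least `x` and receives those of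
  -- `K` in `[t, x)`, too many above `t` to be dominated by `W`.
  by_cases hbig : ∃ r ∈ A.1, x ≤ (i r : ℕ)
  · left
    obtain ⟨r, hr, hxr⟩ := hbig
    obtain ⟨b, hb⟩ := (hA r).2 hr
    have hgb : g (e b) = i r := by
      rw [hg, e.injective.extend_apply, Function.comp_apply, hb]
    let K₁ := K.filter fun a : Fin n => t ≤ (a : ℕ) ∧ (a : ℕ) < x
    let K₂ := K.filter fun a : Fin n => ¬ (t ≤ (a : ℕ) ∧ (a : ℕ) < x)
    have h1 : colexWeight K₁ + colexWeight K₂ = colexWeight K := sum_filter_add_sum_filter_not _ _ _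
    have h2 : colexWeight K₁ < 2 ^ x := colexWeight_lt _ _ fun a ha => (mem_filter.1 ha).2.2
    have h3 : i r ∉ K₂ := by
      intro hmem
      obtain ⟨hmem, hr'⟩ := mem_filter.1 hmem
      obtain ⟨r', hr''⟩ := (hkK _).1 hmem
      rw [← hr''] at hr'
      have h4 := hgk r' hr'
      rw [hr'', ← hgb] at h4
      have h5 := hgi h4
      exact hr' ((he r').1 ⟨b, h5.symm⟩)
    have h4 : insert (i r) K₂ ⊆ univ.image g := by
      intro y hy
      rw [mem_image]
      rcases mem_insert.1 hy with rfl | hy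
      · exact ⟨e b, mem_univ _, hgb⟩
      · obtain ⟨hmem, hr'⟩ := mem_filter.1 hy
        obtain ⟨r', rfl⟩ := (hkK _).1 hmem
        exact ⟨r', mem_univ _, hgk r' hr'⟩
    have h5 : colexWeight (insert (i r) K₂) ≤ colexWeight (univ.image g) :=
      sum_le_sum_of_subset h4
    have h6 : colexWeight (insert (i r) K₂) = 2 ^ (i r : ℕ) + colexWeight K₂ := sum_insert h3
    have h7 : 2 ^ x ≤ 2 ^ (i r : ℕ) := Nat.pow_le_pow_right (by norm_num) hxr
    omega
  · right
    push Not at hbig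
    intro hdom
    have hdom := hdom t
    let I₁ := I.filter fun a : Fin n => x ≤ (a : ℕ)
    let K₁ := K.filter fun a : Fin n => t ≤ (a : ℕ) ∧ (a : ℕ) < x
    have hdisj : Disjoint I₁ K₁ := by
      rw [disjoint_left]
      intro a ha ha'
      have h1 := (mem_filter.1 ha).2
      have h2 := (mem_filter.1 ha').2
      omega
    have hsub : I₁ ∪ K₁ ⊆ (univ.image f).filter fun a : Fin n => t ≤ (a : ℕ) := by
      intro y hy
      rw [mem_filter, mem_image]
      rcases mem_union.1 hy with hy | hy
      · obtain ⟨hmem, hy⟩ := mem_filter.1 hy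
        obtain ⟨r, rfl⟩ := (hiI _).1 hmem
        refine ⟨⟨r, mem_univ _, hfi' r fun hr => ?_⟩, by omega⟩
        exact absurd hy (not_le.2 (hbig r hr))
      · obtain ⟨hmem, hy⟩ := mem_filter.1 hy
        obtain ⟨r, rfl⟩ := (hkK _).1 hmem
        obtain ⟨b, hb⟩ := (he r).2 hy
        refine ⟨⟨subsetEmb A b, mem_univ _, ?_⟩, hy.1⟩
        rw [hf, (subsetEmb A).injective.extend_apply, Function.comp_apply, hb]
    have := card_le_card hsub
    rw [card_union_of_disjoint hdisj] at this
    have h1 : I₁.card + K₁.card ≤ cnt (univ.image f) t := this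
    have h2 : I₁.card = cnt I x := rfl
    have h3 : K₁.card = seg K t x := rfl
    omega

end Minors


/-! ### Standard monomials and straightening -/

section StandardMonomials

variable {n : ℕ}

/-- The product of the minors of `X` with row sets the members of `F`. -/
def listMon {S : Type*} [CommRing S] (X : Matrix (Fin n) (Fin n) S)
    (F : List (Finset (Fin n))) : S :=
  (F.map (setMinor X)).prod

/-- Standardness of a sequence of columns, the last column being listed first, with respect to
the permutation `w`. -/
def IsStandard : Equiv.Perm (Fin n) → List (Finset (Fin n)) → Prop
  | _, [] => True
  | w, K :: F => Dom K (initSet w K.card) ∧ IsStandard (down w K) F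

/-- Induction on the number of columns straightens the tail with respect to `down w K`. A resulting
term that is not standard contains a set `I` not dominated by the meet with `K`, and
`setMinor_mul_mem_span` rewrites the product of the minors of `I` and `K`. The new terms either
contain a set not dominated by `w` or have a head of larger weight, so an inner induction on the
weight of the head terminates. -/
theorem listMon_mem_span (R : Type*) {S : Type*} [CommRing R] [CommRing S] [Algebra R S]
    (X : Matrix (Fin n) (Fin n) S) {L : List ℕ} (hL : L.Pairwise (· ≤ ·))
    (w : Equiv.Perm (Fin n)) {F : List (Finset (Fin n))} (hF : F.map card = L) :
    listMon X F ∈ Submodule.span R {y | ∃ G : List (Finset (Fin n)), G.map card = L ∧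
      (IsStandard w G ∨ ∃ I ∈ G, ¬ Dom I (initSet w I.card)) ∧ y = listMon X G} := by
  induction L generalizing w F with
  | nil =>
    refine Submodule.subset_span ⟨F, hF, Or.inl ?_, rfl⟩
    rw [List.map_eq_nil_iff] at hF
    rw [hF]
    trivial
  | cons l L ih =>
  rw [List.pairwise_cons] at hL
  induction hm : 2 ^ n - colexWeight (F.headI) using Nat.strong_induction_on generalizing F with
  | _ m ihm =>
  obtain ⟨K, F, rfl, hK, hF⟩ := List.map_eq_cons_iff.1 hF
  rw [List.headI_cons] at hm
  by_cases hdom : Dom K (initSet w K.card)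
  swap
  · exact Submodule.subset_span ⟨K :: F, by simp [hK, hF], Or.inr ⟨K, by simp, hdom⟩, rfl⟩
  have h1 := Submodule.mem_map_of_mem (f := LinearMap.mulLeft R (setMinor X K))
    (ih hL.2 (down w K) hF)
  have h2 : LinearMap.mulLeft R (setMinor X K) (listMon X F) = listMon X (K :: F) := by
    simp [listMon]
  rw [h2] at h1
  refine (Submodule.map_le_iff_le_comap.2 (Submodule.span_le.2 ?_)) h1
  rintro _ ⟨G, hG, hG', rfl⟩
  rw [SetLike.mem_coe, Submodule.mem_comap, LinearMap.mulLeft_apply]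
  rcases hG' with hG' | ⟨I, hI, hI'⟩
  · exact Submodule.subset_span ⟨K :: G, by simp [hK, hG], Or.inl ⟨hdom, hG'⟩, by simp [listMon]⟩
  have hIL : I.card ∈ L := hG ▸ List.mem_map_of_mem hI
  have hKI : K.card ≤ I.card := hK ▸ hL.1 _ hIL
  rw [initSet_down hdom hKI (card_le_size I)] at hI'
  simp only [Dom, not_forall, not_le] at hI'
  obtain ⟨x, hx⟩ := hI'
  have hd : Dom K (initSet w I.card) := hdom.trans fun t => cnt_mono (initSet_mono w hKI) t
  -- The index attaining the minimum in the formula for the meet turns failure of dominance at `x`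
  -- into the failing inequality needed for the exchange.
  obtain ⟨t, htx, ht⟩ := (cnt_meet hd x).2
  have hstr := setMinor_mul_mem_span R X hKI htx (W := initSet w I.card) (by omega)
  obtain ⟨G₁, G₂, rfl⟩ := List.append_of_mem hI
  have h3 := Submodule.mem_map_of_mem
    (f := LinearMap.mulRight R (listMon X G₁ * listMon X G₂)) hstr
  have h4 : LinearMap.mulRight R (listMon X G₁ * listMon X G₂) (setMinor X I * setMinor X K) =
      setMinor X K * listMon X (G₁ ++ I :: G₂) := by
    simp only [LinearMap.mulRight_apply, listMon, List.map_append, List.map_cons, List.prod_append,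
      List.prod_cons]
    ring
  rw [h4] at h3
  refine (Submodule.map_le_iff_le_comap.2 (Submodule.span_le.2 ?_)) h3
  rintro _ ⟨I', K', hcI, hcK, hor, rfl⟩
  rw [SetLike.mem_coe, Submodule.mem_comap, LinearMap.mulRight_apply]
  have h5 : setMinor X I' * setMinor X K' * (listMon X G₁ * listMon X G₂) =
      listMon X (K' :: (G₁ ++ I' :: G₂)) := by
    simp only [listMon, List.map_append, List.map_cons, List.prod_append, List.prod_cons]
    ring
  have h6 : (K' :: (G₁ ++ I' :: G₂)).map card = l :: L := by
    rw [← hG, ← hK, ← hcK]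
    simp [hcI]
  rw [h5]
  rcases hor with hlt | hnd
  · refine ihm _ ?_ h6 rfl
    rw [List.headI_cons, ← hm]
    have := colexWeight_le K'
    omega
  · refine Submodule.subset_span ⟨_, h6, Or.inr ⟨I', by simp, ?_⟩, rfl⟩
    rwa [hcI]

end StandardMonomials

/-! ### Evaluation on matrices below a permutation; linear independence -/

section Vanishing

variable {n : ℕ}

/-- The matrices whose column `j` is supported on the rows `≤ w j`. -/
def IsBelow {K : Type*} [Zero K] (w : Equiv.Perm (Fin n)) (M : Matrix (Fin n) (Fin n) K) : Prop :=
  ∀ i j, w j < i → M i j = 0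

theorem map_minor {S S' : Type*} [CommRing S] [CommRing S'] (φ : S →+* S')
    (X : Matrix (Fin n) (Fin n) S) {q : ℕ} (hq : q ≤ n) (f : Fin q → Fin n) :
    φ (minor X hq f) = minor (X.map φ) hq f := by
  rw [minor, RingHom.map_det]
  rfl

theorem map_listMon {S S' : Type*} [CommRing S] [CommRing S'] (φ : S →+* S')
    (X : Matrix (Fin n) (Fin n) S) (F : List (Finset (Fin n))) :
    φ (listMon X F) = listMon (X.map φ) F := by
  rw [listMon, map_list_prod, List.map_map]
  congr 2
  ext I
  exact map_minor φ X _ _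

/-- An initial minor that involves column `b` also involves the earlier column `a`, so the column
operation leaves it unchanged. -/
theorem minor_addCol {S : Type*} [CommRing S] (X : Matrix (Fin n) (Fin n) S) {a b : Fin n}
    (hab : a < b) (c : S) {q : ℕ} (hq : q ≤ n) (f : Fin q → Fin n) :
    minor (X.updateCol b fun i => X i b + c * X i a) hq f = minor X hq f := by
  rw [minor, minor]
  by_cases hb : (b : ℕ) < q
  · refine Eq.trans ?_ (Matrix.det_updateCol_add_smul_self _
      (i := (⟨b, hb⟩ : Fin q)) (j := ⟨a, lt_trans hab hb⟩) (by simpa [Fin.ext_iff] using hab.ne') c)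
    congr 1
    ext i j
    by_cases hj : j = ⟨b, hb⟩
    · subst hj
      simp
    · have : Fin.castLE hq j ≠ b := fun h => hj (by
        rw [Fin.ext_iff] at h ⊢
        exact h)
      simp [Matrix.updateCol_apply, hj, this]
  · congr 1
    ext i j
    have : Fin.castLE hq j ≠ b := fun h => hb (by
      rw [← h]
      exact j.2)
    simp [Matrix.updateCol_apply, this]

theorem listMon_addCol {S : Type*} [CommRing S] (X : Matrix (Fin n) (Fin n) S) {a b : Fin n}
    (hab : a < b) (c : S) (F : List (Finset (Fin n))) :
    listMon (X.updateCol b fun i => X i b + c * X i a) F = listMon X F := by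
  rw [listMon, listMon]
  congr 2
  ext I
  exact minor_addCol X hab c _ _

/-- A combination of minor products that vanishes on the matrices below `w` also vanishes on the
matrices below every smaller permutation. -/
theorem BruhatLE.vanishing {K : Type*} [Field K] [Infinite K] {v w : Equiv.Perm (Fin n)}
    (h : BruhatLE v w) (T : Finset (List (Finset (Fin n)))) (a : List (Finset (Fin n)) → K)
    (hw : ∀ M : Matrix (Fin n) (Fin n) K, IsBelow w M → ∑ F ∈ T, a F * listMon M F = 0) :
    ∀ M : Matrix (Fin n) (Fin n) K, IsBelow v M → ∑ F ∈ T, a F * listMon M F = 0 := by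
  refine h.induction (P := fun w => ∀ M : Matrix (Fin n) (Fin n) K, IsBelow w M →
    ∑ F ∈ T, a F * listMon M F = 0) ?_ hw
  intro w c d hcd hwcd hw M hM
  -- The matrix `M` deformed by adding `X` times column `d` to column `c`. At a value `t ≠ 0`,
  -- adding `-t⁻¹` times the new column `c` to column `d` changes no initial minor and leaves `-t⁻¹`
  -- times the old column `c` there, so the result is below `w`. The combination is a polynomial in
  -- `t` with infinitely many roots, hence it also vanishes at `t = 0`, which is `M`.
  let N : Matrix (Fin n) (Fin n) (Polynomial K) :=
    (M.map Polynomial.C).updateCol c fun i =>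
      Polynomial.C (M i c) + Polynomial.X * Polynomial.C (M i d)
  let p : Polynomial K := ∑ F ∈ T, Polynomial.C (a F) * listMon N F
  have hp : ∀ t : K, p.eval t =
      ∑ F ∈ T, a F * listMon (M.updateCol c fun i => M i c + t * M i d) F := by
    intro t
    rw [Polynomial.eval_finsetSum]
    refine sum_congr rfl fun F _ => ?_
    rw [Polynomial.eval_mul, Polynomial.eval_C, ← Polynomial.coe_evalRingHom, map_listMon]
    congr 2
    ext i j
    by_cases hj : j = c
    · subst hj
      simp only [N, Matrix.map_apply, Matrix.updateCol_self, Polynomial.coe_evalRingHom,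
        Polynomial.eval_add, Polynomial.eval_mul, Polynomial.eval_X, Polynomial.eval_C]
    · simp [N, hj]
  have hroot : ∀ t : K, t ≠ 0 → p.eval t = 0 := by
    intro t ht
    rw [hp]
    have hd : ∀ F, listMon (M.updateCol c fun i => M i c + t * M i d) F = _ := fun F =>
      (listMon_addCol (M.updateCol c fun i => M i c + t * M i d) hcd (-t⁻¹) F).symm
    simp only [hd]
    refine hw _ fun i j hij => ?_
    by_cases hjd : j = d
    · subst hjd
      have h1 := hM i c (by simpa using hij)
      simp [hcd.ne', h1, ht]
    · by_cases hjc : j = c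
      · subst hjc
        have h1 := hM i j (by simpa using hwcd.trans hij)
        have h2 := hM i d (by simpa using hij)
        simp [Matrix.updateCol_apply, hcd.ne, h1, h2]
      · have h1 := hM i j (by
          rwa [Equiv.Perm.mul_apply, Equiv.swap_apply_of_ne_of_ne hjc hjd])
        simp [Matrix.updateCol_apply, hjd, hjc, h1]
  have hp0 : p = 0 := by
    refine Polynomial.eq_zero_of_infinite_isRoot p ?_
    refine Set.Infinite.mono (s := {0}ᶜ) (fun t ht => hroot t ht) ?_
    exact (Set.finite_singleton (0 : K)).infinite_compl
  have h0 := hp 0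
  rw [hp0, Polynomial.eval_zero] at h0
  simpa using h0.symm

/-- Minors vanish below `w` when their row sets are not dominated by the initial sets of `w`. -/
theorem setMinor_eq_zero {K : Type*} [CommRing K] {w : Equiv.Perm (Fin n)}
    {M : Matrix (Fin n) (Fin n) K} (hM : IsBelow w M) {I : Finset (Fin n)}
    (hI : ¬ Dom I (initSet w I.card)) : setMinor M I = 0 := by
  rw [setMinor, minor, Matrix.det_apply]
  refine sum_eq_zero fun σ _ => ?_
  let f := I.orderEmbOfFin rfl
  -- Every term of the Leibniz expansion contains an entry in the vanishing region. Otherwise `f (σ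
  -- i) ≤ w i` for all `i`, and this matching of `I` with the initial set proves dominance.
  suffices h : ∃ i, w (Fin.castLE (card_le_size I) i) < f (σ i) by
    obtain ⟨i, hi⟩ := h
    rw [prod_eq_zero (mem_univ i), smul_zero]
    exact hM _ _ hi
  by_contra hn
  push Not at hn
  refine hI fun t => ?_
  rw [cnt_initSet]
  refine card_le_card_of_surjOn
    (fun j => if h : (j : ℕ) < I.card then f (σ ⟨j, h⟩) else j) ?_
  intro y hy
  obtain ⟨hyI, hty⟩ := mem_filter.1 hy
  have : y ∈ Set.range f := by
    rw [range_orderEmbOfFin]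
    exact hyI
  obtain ⟨r, rfl⟩ := this
  refine ⟨Fin.castLE (card_le_size I) (σ.symm r), ?_, ?_⟩
  · have h1 := hn (σ.symm r)
    rw [Equiv.apply_symm_apply] at h1
    simp only [coe_filter, mem_univ, true_and, Set.mem_ofPred_eq, Fin.val_castLE, Fin.is_lt]
    exact hty.trans h1
  · simp

/-- The minor with rows an initial set of `w` is cancellable among functions on the matrices
below `w`. -/
theorem eq_zero_of_setMinor_mul {K : Type*} [Field K] [Infinite K] {w : Equiv.Perm (Fin n)}
    {I : Finset (Fin n)} (hI : initSet w I.card = I) (T : Finset (List (Finset (Fin n))))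
    (a : List (Finset (Fin n)) → K)
    (h : ∀ M : Matrix (Fin n) (Fin n) K, IsBelow w M →
      setMinor M I * ∑ F ∈ T, a F * listMon M F = 0)
    (M : Matrix (Fin n) (Fin n) K) (hM : IsBelow w M) : ∑ F ∈ T, a F * listMon M F = 0 := by
  let P := MvPolynomial (Fin n × Fin n) K
  -- The generic matrix below `w`. Its entries lie in a polynomial ring, an integral domain, and
  -- over an infinite field functions on these matrices are faithfully given by polynomials.
  let X : Matrix (Fin n) (Fin n) P :=
    Matrix.of fun i j => if i ≤ w j then MvPolynomial.X (i, j) else 0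
  let f : P := ∑ F ∈ T, MvPolynomial.C (a F) * listMon X F
  let mask : (Fin n × Fin n → K) → Matrix (Fin n) (Fin n) K :=
    fun x => Matrix.of fun i j => if i ≤ w j then x (i, j) else 0
  have hmask : ∀ x, IsBelow w (mask x) := fun x i j hij => by
    simp [mask, not_le.2 hij]
  have hX : ∀ x, X.map (MvPolynomial.eval x) = mask x := by
    intro x
    ext i j
    by_cases hij : i ≤ w j <;> simp [X, mask, hij]
  have hf : ∀ x, MvPolynomial.eval x f = ∑ F ∈ T, a F * listMon (mask x) F := by
    intro x
    simp only [f, map_sum, map_mul, MvPolynomial.eval_C, map_listMon, hX]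
  have hI' : ∀ x, MvPolynomial.eval x (setMinor X I) = setMinor (mask x) I := by
    intro x
    rw [setMinor, map_minor, hX]
    rfl
  have hself : ∀ M, IsBelow w M → mask (fun x => M x.1 x.2) = M := by
    intro M hM
    ext i j
    by_cases hij : i ≤ w j
    · simp [mask, hij]
    · simp [mask, hij, hM i j (not_le.1 hij)]
  have hzero : setMinor X I * f = 0 := by
    refine MvPolynomial.funext fun x => ?_
    rw [map_mul, hf, hI', map_zero]
    exact h _ (hmask x)
  rcases mul_eq_zero.1 hzero with h0 | h0
  · exfalso
    -- The permutation matrix of `w` is below `w`, and its minor with rows `I` is a sign, so that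
    -- minor is not the zero polynomial.
    let E : Matrix (Fin n) (Fin n) K := Matrix.of fun i j => if i = w j then 1 else 0
    have hE : IsBelow w E := fun i j hij => by simp [E, hij.ne']
    have h1 : setMinor E I = 0 := by
      have := hI' fun x => E x.1 x.2
      rwa [hself E hE, h0, map_zero, eq_comm] at this
    let g : Fin I.card → Fin n := fun j => w (Fin.castLE (card_le_size I) j)
    have hg : Function.Injective g := w.injective.comp (Fin.castLE_injective _)
    have himg : univ.image g = I := by
      refine eq_of_subset_of_card_le (fun y hy => ?_) ?_
      · obtain ⟨j, -, rfl⟩ := mem_image.1 hy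
        rw [← hI, apply_mem_initSet]
        exact j.2
      · rw [card_image_of_injective _ hg, card_univ, Fintype.card_fin]
    obtain ⟨ε, hε⟩ := minor_of_injective E (card_le_size I) hg
    rw [himg, h1, mul_zero] at hε
    have hone : minor E (card_le_size I) g = 1 := by
      rw [minor]
      convert Matrix.det_one (n := Fin I.card) (R := K) using 2
      ext i j
      simp [E, g, Matrix.one_apply]
    rw [hone] at hε
    exact one_ne_zero hε
  · have := hf fun x => M x.1 x.2
    rwa [hself M hM, h0, map_zero, eq_comm] at this

/-- Standard monomials are linearly independent as functions on the matrices below `w`. -/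
theorem eq_zero_of_isStandard {K : Type*} [Field K] [Infinite K] {L : List ℕ}
    (w : Equiv.Perm (Fin n)) (T : Finset (List (Finset (Fin n))))
    (hT : ∀ F ∈ T, F.map card = L ∧ IsStandard w F) (a : List (Finset (Fin n)) → K)
    (h : ∀ M : Matrix (Fin n) (Fin n) K, IsBelow w M → ∑ F ∈ T, a F * listMon M F = 0) :
    ∀ F ∈ T, a F = 0 := by
  classical
  induction L generalizing w T a with
  | nil =>
    intro F hF
    have hnil : ∀ F ∈ T, F = [] := fun F hF => List.map_eq_nil_iff.1 (hT F hF).1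
    have h0 := h 0 fun _ _ _ => rfl
    rw [sum_eq_single_of_mem F hF fun G hG hne => absurd ((hnil G hG).trans (hnil F hF).symm) hne,
      hnil F hF] at h0
    rw [hnil F hF]
    simpa [listMon] using h0
  | cons l L ih =>
  by_contra hne
  push Not at hne
  -- This weight is strictly monotone for dominance, so a head of least weight among the nonzero
  -- coefficients strictly dominates no other such head.
  let wt : Finset (Fin n) → ℕ := fun A => ∑ t ∈ range n, cnt A t
  obtain ⟨F₀, hF₀, hmin⟩ := exists_min_image (T.filter fun F => a F ≠ 0) (fun F => wt F.headI) (by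
    obtain ⟨F, hF, hF'⟩ := hne
    exact ⟨F, mem_filter.2 ⟨hF, hF'⟩⟩)
  obtain ⟨hF₀, ha₀⟩ := mem_filter.1 hF₀
  obtain ⟨I, D₀, rfl, hI, -⟩ := List.map_eq_cons_iff.1 (hT F₀ hF₀).1
  rw [List.headI_cons] at hmin
  have hdom : Dom I (initSet w I.card) := (hT _ hF₀).2.1
  have hIv := initSet_down_card hdom
  have hv := (down_le hdom).vanishing T a h
  have hinj : Function.Injective (List.cons I) := List.cons_injective
  refine ha₀ (ih (down w I) (T.preimage (List.cons I) hinj.injOn) ?_ (fun D => a (I :: D))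
    (eq_zero_of_setMinor_mul hIv _ _ fun M hM => ?_) D₀ (mem_preimage.2 hF₀))
  · intro D hD
    obtain ⟨h1, h2⟩ := hT _ (mem_preimage.1 hD)
    exact ⟨by simpa using (List.cons.inj h1).2, h2.2⟩
  · rw [← hv M hM, ← sum_preimage (List.cons I) T hinj.injOn (fun F => a F * listMon M F), mul_sum]
    · refine sum_congr rfl fun D _ => ?_
      simp only [listMon, List.map_cons, List.prod_cons]
      ring
    · intro F hF hFI
      by_cases haF : a F = 0
      · rw [haF, zero_mul]
      obtain ⟨J, D, rfl, hJ, -⟩ := List.map_eq_cons_iff.1 (hT F hF).1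
      have hle := hmin _ (mem_filter.2 ⟨hF, haF⟩)
      rw [List.headI_cons] at hle
      -- If it did not vanish below `down w I`, then `J` would be dominated by `I`; minimality of
      -- the weight would force equal counts and `J = I`.
      have : setMinor M J = 0 := by
        refine setMinor_eq_zero hM fun hJv => hFI ?_
        rw [hJ, ← hI, hIv] at hJv
        have heq : ∀ t ∈ range n, cnt J t = cnt I t :=
          (sum_eq_sum_iff_of_le fun t _ => hJv t).1
            (le_antisymm (sum_le_sum fun t _ => hJv t) hle)
        have : J = I := cnt_injective (funext fun t => by
          by_cases ht : t < n
          · exact heq t (mem_range.2 ht)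
          · rw [cnt_of_le _ (not_lt.1 ht), cnt_of_le _ (not_lt.1 ht)])
        exact ⟨D, by rw [this]⟩
      simp [listMon, this]

end Vanishing


/-! ### Merging a decreasing sequence with a column -/

section Merging

/-- Merging the decreasing sequence `e` of length `L` with the increasing sequence `k`: the `i`-th
term of `e` is replaced by the largest remaining term of `k` whenever that is not smaller; `h i` is
the number of terms of `k` that remain before this step. -/
structure IsMerge (L : ℕ) (e : ℕ → ℕ) (z : ℕ) (k : ℕ → ℕ) (h e' : ℕ → ℕ) : Prop where
  anti : ∀ i j, i < j → j < L → e j < e i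
  mono : ∀ i j, i < j → j < z → k i < k j
  zero : h 0 = z
  step : ∀ i < L, (0 < h i ∧ e i ≤ k (h i - 1) ∧ h (i + 1) = h i - 1 ∧ e' i = k (h i - 1)) ∨
    ((0 < h i → k (h i - 1) < e i) ∧ h (i + 1) = h i ∧ e' i = e i)

/-- The number of terms of `e` of index `< L` that are at least `t`. -/
def seqCnt (L : ℕ) (e : ℕ → ℕ) (t : ℕ) : ℕ := ((range L).filter fun i => t ≤ e i).card

/-- The number of terms of `k` of index `< z` in `[t, x)`. -/
def seqSeg (z : ℕ) (k : ℕ → ℕ) (t x : ℕ) : ℕ :=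
  ((range z).filter fun j => t ≤ k j ∧ k j < x).card

variable {L z : ℕ} {e k h e' : ℕ → ℕ}

theorem IsMerge.le_size (H : IsMerge L e z k h e') : ∀ i ≤ L, h i ≤ z := by
  intro i
  induction i with
  | zero => intro _; exact H.zero.le
  | succ i ih =>
    intro hi
    have := ih (by omega)
    rcases H.step i (by omega) with h1 | h1 <;> omega

theorem IsMerge.le (H : IsMerge L e z k h e') {i : ℕ} (hi : i < L) : e i ≤ e' i := by
  rcases H.step i hi with h1 | h1 <;> omega

theorem IsMerge.lt_succ (H : IsMerge L e z k h e') {i : ℕ} (hi : i + 1 < L) :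
    e' (i + 1) < e' i := by
  have h1 := H.anti i (i + 1) (by omega) hi
  have h2 := H.le_size i (by omega)
  rcases H.step i (by omega) with ⟨a1, a2, a3, a4⟩ | ⟨a1, a2, a3⟩ <;>
    rcases H.step (i + 1) hi with ⟨b1, b2, b3, b4⟩ | ⟨b1, b2, b3⟩
  · rw [a4, b4]
    exact H.mono _ _ (by omega) (by omega)
  · omega
  · rw [b4, a3, a2]
    exact a1 (by omega)
  · omega

theorem IsMerge.anti' (H : IsMerge L e z k h e') : ∀ i j, i < j → j < L → e' j < e' i := by
  intro i j hij hj
  induction j, hij using Nat.le_induction with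
  | base => exact H.lt_succ hj
  | succ j hij ih => exact (H.lt_succ hj).trans (ih (by omega))

/-- At most `L - i` terms of `k` remain before step `i`. In the extreme case `h i = L - i`, the
hypothesis for `j = h i - 1` compares exactly `e i` with the next term of `k`, so that term is
consumed. -/
theorem IsMerge.exhausted (H : IsMerge L e z k h e') (hz : z ≤ L)
    (hle : ∀ j < z, e (L - 1 - j) ≤ k j) : h L = 0 := by
  have key : ∀ i ≤ L, h i ≤ L - i := by
    intro i
    induction i with
    | zero => intro _; rw [H.zero]; omega
    | succ i ih =>
      intro hi
      have h1 := ih (by omega)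
      have h2 := H.le_size i (by omega)
      rcases H.step i (by omega) with ⟨a1, a2, a3, a4⟩ | ⟨a1, a2, a3⟩
      · omega
      · by_contra hn
        have h3 := a1 (by omega)
        have h4 := hle (h i - 1) (by omega)
        rw [show L - 1 - (h i - 1) = i by omega] at h4
        omega
  have := key L le_rfl
  omega

theorem IsMerge.mem_of_exhausted (H : IsMerge L e z k h e') (h0 : h L = 0) {j : ℕ} (hj : j < z) :
    ∃ i < L, e' i = k j := by
  have key : ∀ i ≤ L, h i ≤ j → ∃ i' < i, e' i' = k j := by
    intro i
    induction i with
    | zero => intro _ h1; rw [H.zero] at h1; omega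
    | succ i ih =>
      intro hi h1
      by_cases h2 : h i ≤ j
      · obtain ⟨i', hi', h3⟩ := ih (by omega) h2
        exact ⟨i', by omega, h3⟩
      · rcases H.step i (by omega) with ⟨a1, a2, a3, a4⟩ | ⟨a1, a2, a3⟩
        · refine ⟨i, by omega, ?_⟩
          rw [a4]
          congr 1
          omega
        · omega
  exact key L le_rfl (by omega)

/-- Merging never lowers a term, so terms at least `x` stay so, and exhaustion ensures that all
terms of `k` in `[t, x)` appear as well. With `seqCnt_le`, the count of the merged sequence at `t`
is the maximum of the left side over `x ≥ t`. -/
theorem IsMerge.seqCnt_ge (H : IsMerge L e z k h e') (h0 : h L = 0) {t x : ℕ} (htx : t ≤ x) :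
    seqCnt L e x + seqSeg z k t x ≤ seqCnt L e' t := by
  have h1 : ((range L).filter fun i => t ≤ e' i ∧ e' i < x).card +
      ((range L).filter fun i => x ≤ e' i).card = seqCnt L e' t := by
    rw [seqCnt, ← card_union_of_disjoint]
    · congr 1
      ext i
      simp only [mem_union, mem_filter]
      grind
    · rw [disjoint_left]
      intro i
      simp only [mem_filter]
      grind
  have h2 : seqCnt L e x ≤ ((range L).filter fun i => x ≤ e' i).card := by
    refine card_le_card fun i hi => ?_
    simp only [mem_filter, mem_range] at hi ⊢
    exact ⟨hi.1, hi.2.trans (H.le hi.1)⟩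
  have h3 : seqSeg z k t x ≤ ((range L).filter fun i => t ≤ e' i ∧ e' i < x).card := by
    choose! f hf using fun j (hj : j < z) => H.mem_of_exhausted h0 hj
    refine card_le_card_of_injOn f ?_ ?_
    · intro j hj
      simp only [coe_filter, mem_range, Set.mem_ofPred_eq] at hj ⊢
      have := hf j hj.1
      rw [this.2]
      exact ⟨this.1, hj.2⟩
    · intro i hi j hj hij
      simp only [coe_filter, mem_range, Set.mem_ofPred_eq] at hi hj
      have h4 := (hf i hi.1).2
      rw [hij, (hf j hj.1).2] at h4
      rcases lt_trichotomy i j with h5 | h5 | h5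
      · have := H.mono i j h5 hj.1
        omega
      · exact h5
      · have := H.mono j i h5 hi.1
        omega
  omega

/-- Among the merged terms at least `t`, let `x` be the last one kept from `e`, or a bound above all
of `k` if there is none. The earlier terms of `e` exceed `x`, and the later merged terms are terms
of `k` in `[t, x)`. Exhaustion is not needed for this bound. -/
theorem IsMerge.seqCnt_le (H : IsMerge L e z k h e') (t : ℕ) :
    ∃ x, t ≤ x ∧ seqCnt L e' t ≤ seqCnt L e x + seqSeg z k t x := by
  have key : ∀ i ≤ L, (∀ i' < i, t ≤ e' i') → ∃ x, t ≤ x ∧ (∀ j < h i, k j < x) ∧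
      i ≤ ((range i).filter fun i' => x ≤ e i').card +
        ((Ico (h i) z).filter fun j => t ≤ k j ∧ k j < x).card := by
    intro i
    induction i with
    | zero =>
      intro _ _
      refine ⟨max t (k (z - 1) + 1), le_max_left _ _, fun j hj => ?_, by omega⟩
      rw [H.zero] at hj
      have : k j ≤ k (z - 1) := by
        rcases (show j ≤ z - 1 by omega).lt_or_eq with h1 | h1
        · exact (H.mono _ _ h1 (by omega)).le
        · rw [h1]
      omega
    | succ i ih =>
      intro hi ht
      have h2 := H.le_size i (by omega)
      rcases H.step i (by omega) with ⟨a1, a2, a3, a4⟩ | ⟨a1, a2, a3⟩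
      · obtain ⟨x, hx1, hx2, hx3⟩ := ih (by omega) fun i' hi' => ht i' (by omega)
        refine ⟨x, hx1, fun j hj => hx2 j (by omega), ?_⟩
        have h3 : ((range i).filter fun i' => x ≤ e i').card ≤
            ((range (i + 1)).filter fun i' => x ≤ e i').card :=
          card_le_card (filter_subset_filter _ (range_mono (by omega)))
        have h4 : ((Ico (h i) z).filter fun j => t ≤ k j ∧ k j < x).card <
            ((Ico (h (i + 1)) z).filter fun j => t ≤ k j ∧ k j < x).card := by
          refine card_lt_card ?_
          rw [ssubset_iff_of_subset]
          · refine ⟨h i - 1, ?_, ?_⟩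
            · rw [mem_filter, mem_Ico, ← a4]
              have h5 := ht i (by omega)
              have h6 := hx2 (h i - 1) (by omega)
              omega
            · rw [mem_filter, mem_Ico]
              omega
          · intro j
            simp only [mem_filter, mem_Ico]
            omega
        omega
      -- A kept term resets the threshold: all terms of `e` up to `i` are at least `e i`, and all
      -- remaining terms of `k` are smaller.
      · refine ⟨e i, ?_, fun j hj => ?_, ?_⟩
        · rw [← a3]
          exact ht i (by omega)
        · have h5 := a1 (by omega)
          rcases (show j ≤ h i - 1 by omega).lt_or_eq with h6 | h6
          · exact (H.mono _ _ h6 (by omega)).trans h5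
          · rw [h6]
            exact h5
        · rw [filter_true_of_mem, card_range]
          · omega
          · intro i' hi'
            rw [mem_range] at hi'
            rcases (show i' ≤ i by omega).lt_or_eq with h6 | h6
            · exact (H.anti _ _ h6 (by omega)).le
            · rw [h6]
  have hL : seqCnt L e' t ≤ L := (card_filter_le _ _).trans_eq (card_range L)
  obtain ⟨x, hx1, -, hx3⟩ := key (seqCnt L e' t) hL (by
    intro i hi
    by_contra hn
    have : (range L).filter (fun i => t ≤ e' i) ⊆ range i := by
      intro j hj
      rw [mem_filter, mem_range] at hj
      rw [mem_range]
      by_contra hij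
      rcases (not_lt.1 hij).lt_or_eq with h1 | h1
      · have := H.anti' _ _ h1 hj.1
        omega
      · rw [← h1] at hj
        omega
    have := card_le_card this
    rw [card_range] at this
    exact absurd hi (not_lt.2 this))
  refine ⟨x, hx1, hx3.trans (add_le_add ?_ ?_)⟩
  · exact card_le_card (filter_subset_filter _ (range_mono hL))
  · refine card_le_card (filter_subset_filter _ fun j => ?_)
    rw [mem_Ico, mem_range]
    exact fun h => h.2

end Merging

/-! ### Earliest weakly increasing subsequences, column by column -/

section EarliestSubsequence

variable {α : Type*} (val : α → ℕ)

theorem ewisFrom_append (cur : α) (l₁ l₂ : List α) :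
    ewisFrom val cur (l₁ ++ l₂) = ewisFrom val cur l₁ ++
      ewisFrom val ((ewisFrom val cur l₁).getLastD cur) l₂ := by
  induction l₁ generalizing cur with
  | nil => simp [ewisFrom]
  | cons x l ih =>
    simp only [List.cons_append, ewisFrom]
    split_ifs
    · rw [ih, List.cons_append, List.getLastD_cons]
    · rw [ih]

theorem ewis_append {l₁ : List α} (h : l₁ ≠ []) (l₂ : List α) (a : α) :
    ewis val (l₁ ++ l₂) = ewis val l₁ ++ ewisFrom val ((ewis val l₁).getLastD a) l₂ := by
  cases l₁ with
  | nil => exact absurd rfl h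
  | cons x l => simp only [List.cons_append, ewis, ewisFrom_append, List.getLastD_cons]

theorem mem_of_mem_ewisFrom {cur x : α} {l : List α} (h : x ∈ ewisFrom val cur l) : x ∈ l := by
  induction l generalizing cur with
  | nil => simp [ewisFrom] at h
  | cons y l ih =>
    simp only [ewisFrom] at h
    split_ifs at h
    · rcases List.mem_cons.1 h with rfl | h
      · simp
      · exact List.mem_cons_of_mem _ (ih h)
    · exact List.mem_cons_of_mem _ (ih h)

theorem mem_of_mem_ewis {x : α} {l : List α} (h : x ∈ ewis val l) : x ∈ l := by
  cases l with
  | nil => simp [ewis] at h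
  | cons y l =>
    simp only [ewis] at h
    rcases List.mem_cons.1 h with rfl | h
    · simp
    · exact List.mem_cons_of_mem _ (mem_of_mem_ewisFrom val h)

theorem ewis_ne_nil {l : List α} (h : l ≠ []) : ewis val l ≠ [] := by
  cases l with
  | nil => exact absurd rfl h
  | cons y l => simp [ewis]

/-- The columns among the first `d` that are scanned: those from `c` on that have unmarked
locations. -/
def colList {m : ℕ} (c : Fin m) (h : Fin m → ℕ) (d : ℕ) : List (Fin m) :=
  ((List.finRange m).take d).filter fun j => decide (c ≤ j ∧ 0 < h j)

variable {m : ℕ} (c : Fin m) (h : Fin m → ℕ)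

theorem lt_of_mem_colList {d : ℕ} {j : Fin m} (hj : j ∈ colList c h d) : (j : ℕ) < d := by
  have := List.mem_of_mem_filter hj
  rw [List.mem_take_iff_getElem] at this
  obtain ⟨i, hi, rfl⟩ := this
  simp only [List.getElem_finRange, Fin.val_cast]
  omega

theorem le_of_mem_colList {d : ℕ} {j : Fin m} (hj : j ∈ colList c h d) : c ≤ j := by
  have := List.of_mem_filter hj
  simp only [decide_eq_true_eq] at this
  exact this.1

theorem colList_succ (d : Fin m) : colList c h (d + 1) =
    colList c h d ++ if c ≤ d ∧ 0 < h d then [d] else [] := by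
  have : (List.finRange m).take (d + 1) = (List.finRange m).take d ++ [d] := by
    rw [List.take_succ_eq_append_getElem (by simp)]
    simp
  rw [colList, this, List.filter_append, colList]
  congr 1
  by_cases hd : c ≤ d ∧ 0 < h d <;> simp [hd]

theorem colList_self : colList c h c = [] := by
  rw [List.eq_nil_iff_forall_not_mem]
  intro j hj
  have h1 := lt_of_mem_colList c h hj
  have h2 : (c : ℕ) ≤ j := le_of_mem_colList c h hj
  omega

theorem colList_succ_self (hc : 0 < h c) : colList c h (c + 1) = [c] := by
  rw [colList_succ, colList_self, if_pos ⟨le_rfl, hc⟩, List.nil_append]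

theorem colList_ne_nil (hc : 0 < h c) {d : ℕ} (hd : (c : ℕ) < d) : colList c h d ≠ [] := by
  have h1 : c ∈ colList c h (c + 1) := by rw [colList_succ_self c h hc]; simp
  have h2 : c ∈ colList c h d := by
    rw [colList, List.mem_filter] at h1 ⊢
    refine ⟨?_, h1.2⟩
    exact (List.take_sublist_take_left hd).subset h1.1
  exact List.ne_nil_of_mem h2

theorem exists_colList_append (d : ℕ) : ∃ l : List (Fin m),
    ((List.finRange m).filter fun j => decide (c ≤ j ∧ 0 < h j)) = colList c h d ++ l ∧
      ∀ j ∈ l, d ≤ (j : ℕ) := by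
  refine ⟨((List.finRange m).drop d).filter fun j => decide (c ≤ j ∧ 0 < h j), ?_, ?_⟩
  · rw [colList, ← List.filter_append, List.take_append_drop]
  · intro j hj
    have := List.mem_of_mem_filter hj
    rw [List.mem_drop_iff_getElem] at this
    obtain ⟨i, hi, rfl⟩ := this
    simp

/-- One step of a scan. -/
theorem ewis_colList_succ (val : Fin m → ℕ) (hc : 0 < h c) {d : Fin m} (hd : c < d) :
    ewis val (colList c h (d + 1)) = ewis val (colList c h d) ++
      if 0 < h d ∧ val ((ewis val (colList c h d)).getLastD c) ≤ val d then [d] else [] := by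
  rw [colList_succ]
  by_cases h1 : 0 < h d
  · rw [if_pos ⟨hd.le, h1⟩, ewis_append val (colList_ne_nil c h hc hd) _ c]
    simp [ewisFrom, h1]
  · simp [h1]

/-- Columns to the right of `d` have no influence on whether `d` is taken. The criterion is the
comparison made in one step of a merge. -/
theorem mem_ewis_iff (val : Fin m → ℕ) (hc : 0 < h c) {d : Fin m} (hd : c < d) :
    d ∈ ewis val ((List.finRange m).filter fun j => decide (c ≤ j ∧ 0 < h j)) ↔
      0 < h d ∧ val ((ewis val (colList c h d)).getLastD c) ≤ val d := by
  obtain ⟨l, hl, hl'⟩ := exists_colList_append c h (d + 1)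
  have hcd : (c : ℕ) < d + 1 := Nat.lt_succ_of_lt hd
  rw [hl, ewis_append val (colList_ne_nil c h hc hcd) _ c, List.mem_append,
    ewis_colList_succ c h val hc hd, List.mem_append]
  have h1 : d ∉ ewis val (colList c h d) := fun hmem =>
    (lt_of_mem_colList c h (mem_of_mem_ewis val hmem)).ne rfl
  constructor
  · rintro ((h2 | h2) | h2)
    · exact absurd h2 h1
    · split_ifs at h2 with h3
      · exact h3
      · simp at h2
    · have := hl' _ (mem_of_mem_ewisFrom val h2)
      omega
  · intro h2
    left
    right
    rw [if_pos h2]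
    simp

theorem self_mem_ewis (val : Fin m → ℕ) (hc : 0 < h c) :
    c ∈ ewis val ((List.finRange m).filter fun j => decide (c ≤ j ∧ 0 < h j)) := by
  obtain ⟨l, hl, -⟩ := exists_colList_append c h (c + 1)
  rw [hl, colList_succ_self c h hc]
  simp [ewis]

end EarliestSubsequence


/-! ### Sequences listed from the last term to the first -/

section Prefixes

variable {α β : Type*}

/-- The list `[f (d - 1), …, f 0]`. -/
def revPrefix (f : ℕ → α) : ℕ → List α
  | 0 => []
  | d + 1 => f d :: revPrefix f d

theorem map_revPrefix (g : α → β) (f : ℕ → α) (d : ℕ) :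
    (revPrefix f d).map g = revPrefix (g ∘ f) d := by
  induction d with
  | zero => rfl
  | succ d ih => rw [revPrefix, List.map_cons, ih, revPrefix, Function.comp_apply]

theorem length_revPrefix (f : ℕ → α) (d : ℕ) : (revPrefix f d).length = d := by
  induction d with
  | zero => rfl
  | succ d ih => rw [revPrefix, List.length_cons, ih]

theorem revPrefix_inj {f g : ℕ → α} {d : ℕ} :
    revPrefix f d = revPrefix g d ↔ ∀ j < d, f j = g j := by
  induction d with
  | zero => simp [revPrefix]
  | succ d ih =>
    rw [revPrefix, revPrefix, List.cons.injEq, ih]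
    constructor
    · rintro ⟨h1, h2⟩ j hj
      rcases (Nat.lt_succ_iff.1 hj).lt_or_eq with h3 | rfl
      · exact h2 j h3
      · exact h1
    · exact fun h => ⟨h d (Nat.lt_succ_self d), fun j hj => h j (hj.trans (Nat.lt_succ_self d))⟩

theorem exists_eq_revPrefix [Inhabited α] (G : List α) : ∃ f, G = revPrefix f G.length := by
  induction G with
  | nil => exact ⟨fun _ => default, rfl⟩
  | cons a G ih =>
    obtain ⟨f, hf⟩ := ih
    refine ⟨Function.update f G.length a, ?_⟩
    rw [List.length_cons, revPrefix, Function.update_self]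
    congr 1
    conv_lhs => rw [hf]
    exact revPrefix_inj.2 fun j hj => (Function.update_of_ne hj.ne _ _).symm

theorem mem_revPrefix {f : ℕ → α} {d : ℕ} {x : α} : x ∈ revPrefix f d ↔ ∃ j < d, f j = x := by
  induction d with
  | zero => simp [revPrefix]
  | succ d ih =>
    rw [revPrefix, List.mem_cons, ih]
    constructor
    · rintro (rfl | ⟨j, hj, rfl⟩)
      · exact ⟨d, Nat.lt_succ_self d, rfl⟩
      · exact ⟨j, hj.trans (Nat.lt_succ_self d), rfl⟩
    · rintro ⟨j, hj, rfl⟩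
      rcases (Nat.lt_succ_iff.1 hj).lt_or_eq with h3 | rfl
      · exact Or.inr ⟨j, h3, rfl⟩
      · exact Or.inl rfl

theorem pairwise_revPrefix {f : ℕ → ℕ} (hf : Antitone f) (d : ℕ) :
    (revPrefix f d).Pairwise (· ≤ ·) := by
  induction d with
  | zero => exact List.Pairwise.nil
  | succ d ih =>
    refine List.pairwise_cons.2 ⟨fun x hx => ?_, ih⟩
    obtain ⟨j, hj, rfl⟩ := mem_revPrefix.1 hx
    exact hf hj.le

end Prefixes

/-! ### Entrywise comparison by counting -/

section Counting

theorem forall_le_iff_card_le {L : ℕ} {f g : Fin L → ℕ} (hf : Monotone f) (hg : Monotone g) :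
    (∀ r, f r ≤ g r) ↔ ∀ t, (univ.filter fun r => t ≤ f r).card ≤
      (univ.filter fun r => t ≤ g r).card := by
  constructor
  · intro h t
    refine card_le_card fun r => ?_
    simp only [mem_filter, mem_univ, true_and]
    exact fun hr => hr.trans (h r)
  · intro h r
    by_contra hn
    push Not at hn
    have h1 : Ici r ⊆ univ.filter fun i => f r ≤ f i := fun i hi => by
      simpa using hf (mem_Ici.1 hi)
    have h2 : (univ.filter fun i => f r ≤ g i) ⊆ Ioi r := fun i hi => by
      rw [mem_Ioi]
      by_contra hir
      have h3 := hg (not_lt.1 hir)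
      have h4 := (mem_filter.1 hi).2
      omega
    have h3 := card_le_card h1
    have h4 := card_le_card h2
    have h5 := h (f r)
    rw [Fin.card_Ici] at h3
    rw [Fin.card_Ioi] at h4
    omega

theorem cnt_image {n L : ℕ} {f : Fin L → Fin n} (hf : Function.Injective f) (t : ℕ) :
    cnt (univ.image f) t = (univ.filter fun r => t ≤ (f r : ℕ)).card := by
  rw [cnt, filter_image, card_image_of_injective _ hf]

theorem seg_image {n L : ℕ} {f : Fin L → Fin n} (hf : Function.Injective f) (t x : ℕ) :
    seg (univ.image f) t x = (univ.filter fun r => t ≤ (f r : ℕ) ∧ (f r : ℕ) < x).card := by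
  rw [seg, filter_image, card_image_of_injective _ hf]

/-- Counting a sequence read from the bottom of a column to its top. -/
theorem card_filter_reverse {L : ℕ} (f : ℕ → ℕ) (t : ℕ) :
    (univ.filter fun r : Fin L => t ≤ f (L - 1 - r)).card = seqCnt L f t := by
  refine card_bij (fun r _ => L - 1 - r) ?_ ?_ ?_
  · intro r hr
    simp only [mem_filter, mem_univ, true_and, mem_range] at hr ⊢
    exact ⟨by omega, hr⟩
  · intro r _ r' _ h
    ext
    omega
  · intro i hi
    simp only [mem_filter, mem_range] at hi
    refine ⟨⟨L - 1 - i, by omega⟩, ?_, ?_⟩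
    · simp only [mem_filter, mem_univ, true_and]
      rw [show L - 1 - (L - 1 - i) = i by omega]
      exact hi.2
    · simp only
      omega

end Counting

/-! ### Scanning as iterated merging, and its equivalence with standardness -/

section ScanningValues

variable {n : ℕ} {s : Shape n} (T : Filling s) (c : Fin s.numCols)

theorem entry_of_lt {j : Fin s.numCols} {r : ℕ} (h : r < s.len j) :
    entry T j r = T j ⟨r, h⟩ := by rw [entry, dif_pos h]

/-- The last value of the part within the first `d` columns of the `i`-th scanning path from
column `c`. -/
def scanValue (d i : ℕ) : ℕ :=
  bottomValue T (heights T c i) ((ewis (bottomValue T (heights T c i))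
    (colList c (heights T c i) d)).getLastD c)

theorem heights_self {i : ℕ} (hi : i ≤ s.len c) : heights T c i c = s.len c - i := by
  induction i with
  | zero => rfl
  | succ i ih =>
    have h1 := ih (by omega)
    have h2 : c ∈ scanOnce T c (heights T c i) := self_mem_ewis c _ _ (by omega)
    simp only [heights, if_pos h2]
    omega

theorem scanValue_start {i : ℕ} (hi : i < s.len c) :
    scanValue T c (c + 1) i = entry T c (s.len c - 1 - i) := by
  have h1 := heights_self T c hi.le
  rw [scanValue, colList_succ_self c _ (by omega)]
  simp only [ewis, ewisFrom, List.getLastD_cons, List.getLastD_nil, bottomValue, h1]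
  congr 1
  omega

theorem scanningTableau_eq (r : Fin (s.len c)) :
    scanningTableau T c r = scanValue T c s.numCols (s.len c - 1 - r) := by
  have h1 := heights_self T c (i := s.len c - 1 - r) (by omega)
  have h2 : colList c (heights T c (s.len c - 1 - r)) s.numCols = (List.finRange s.numCols).filter
      fun j => decide (c ≤ j ∧ 0 < heights T c (s.len c - 1 - r) j) := by
    rw [colList, List.take_of_length_le (by simp)]
  have h3 : scanOnce T c (heights T c (s.len c - 1 - r)) ≠ [] := by
    refine ewis_ne_nil _ ?_
    rw [← h2]
    exact colList_ne_nil c _ (by omega) c.2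
  rw [scanningTableau, scanValue, h2]
  change _ = bottomValue T _ ((scanOnce T c (heights T c (s.len c - 1 - r))).getLastD c)
  rw [List.getLastD_eq_getLast?, List.getLast?_eq_some_getLast h3]
  rfl

variable {T}

theorem IsTabloid.entry_lt (hT : IsTabloid T) (j : Fin s.numCols) (a b : ℕ) (hab : a < b)
    (hb : b < s.len j) : entry T j a < entry T j b := by
  rw [entry_of_lt T hb, entry_of_lt T (hab.trans hb)]
  exact hT j (Fin.mk_lt_mk.2 hab)

/-- The `i`-th scan is the `i`-th step of the merge: its path, ending at `scanValue T c d i`, takes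
the lowest unmarked entry of column `d` whenever that is not smaller. Strict decrease of the
endpoints is assumed here because `scanValue_anti` obtains it inductively from this very lemma. -/
theorem isMerge_scanValue (hT : IsTabloid T) {c d : Fin s.numCols} (hcd : c < d)
    (hanti : ∀ i j, i < j → j < s.len c → scanValue T c d j < scanValue T c d i) :
    IsMerge (s.len c) (scanValue T c d) (s.len d) (entry T d) (fun i => heights T c i d)
      (scanValue T c (d + 1)) where
  anti := hanti
  mono := hT.entry_lt d
  zero := rfl
  step i hi := by
    have hc : 0 < heights T c i c := by
      rw [heights_self T c hi.le]
      omega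
    have hmem := mem_ewis_iff c (heights T c i) (bottomValue T (heights T c i)) hc hcd
    have hsucc := ewis_colList_succ c (heights T c i) (bottomValue T (heights T c i)) hc hcd
    change d ∈ scanOnce T c (heights T c i) ↔ 0 < heights T c i d ∧ scanValue T c d i ≤
      entry T d (heights T c i d - 1) at hmem
    by_cases hd : d ∈ scanOnce T c (heights T c i)
    · left
      obtain ⟨h1, h2⟩ := hmem.1 hd
      refine ⟨h1, h2, by simp only [heights, if_pos hd], ?_⟩
      rw [scanValue, hsucc, if_pos ⟨h1, h2⟩, List.getLastD_concat]
      rfl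
    · right
      have h1 := fun h => hd (hmem.2 h)
      refine ⟨fun h => ?_, by simp only [heights, if_neg hd], ?_⟩
      · by_contra hn
        exact h1 ⟨h, not_lt.1 hn⟩
      · rw [scanValue, hsucc, if_neg, List.append_nil]
        · rfl
        · exact h1

theorem scanValue_anti (hT : IsTabloid T) (c : Fin s.numCols) {d : ℕ} (hcd : (c : ℕ) < d)
    (hd : d ≤ s.numCols) :
    ∀ i j, i < j → j < s.len c → scanValue T c d j < scanValue T c d i := by
  induction d, hcd using Nat.le_induction with
  | base =>
    intro i j hij hj
    rw [Nat.succ_eq_add_one, scanValue_start T c hj, scanValue_start T c (hij.trans hj)]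
    exact hT.entry_lt c _ _ (by omega) (by omega)
  | succ d hcd ih =>
    exact (isMerge_scanValue hT (c := c) (d := ⟨d, hd⟩) hcd (ih (by omega))).anti'

theorem isMerge_scan (hT : IsTabloid T) {c d : Fin s.numCols} (hcd : c < d) :
    IsMerge (s.len c) (scanValue T c d) (s.len d) (entry T d) (fun i => heights T c i d)
      (scanValue T c (d + 1)) :=
  isMerge_scanValue hT hcd (scanValue_anti hT c hcd d.2.le)

/-- The set of values in column `d`. -/
def colSet (T : Filling s) (d : ℕ) : Finset (Fin n) :=
  if h : d < s.numCols then univ.image (T ⟨d, h⟩) else ∅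

theorem colSet_val (T : Filling s) (d : Fin s.numCols) : colSet T d = univ.image (T d) := by
  rw [colSet, dif_pos d.2]

theorem card_colSet (hT : IsTabloid T) (d : Fin s.numCols) : (colSet T d).card = s.len d := by
  rw [colSet_val, card_image_of_injective _ (hT d).injective, card_univ, Fintype.card_fin]

theorem seqSeg_entry (hT : IsTabloid T) (d : Fin s.numCols) (t x : ℕ) :
    seqSeg (s.len d) (entry T d) t x = seg (colSet T d) t x := by
  rw [colSet_val, seg_image (hT d).injective, seqSeg, card_filter, card_filter,
    sum_range fun j => if t ≤ entry T d j ∧ entry T d j < x then 1 else 0]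
  refine sum_congr rfl fun j _ => ?_
  rw [entry_of_lt T j.2]

theorem seqCnt_start (hT : IsTabloid T) (c : Fin s.numCols) (t : ℕ) :
    seqCnt (s.len c) (scanValue T c (c + 1)) t = cnt (colSet T c) t := by
  rw [colSet_val, cnt_image (hT c).injective, ← card_filter_reverse]
  congr 1
  refine filter_congr fun r _ => ?_
  rw [scanValue_start T c (by omega), entry_of_lt T (r := s.len c - 1 - (s.len c - 1 - r)) (by omega)]
  have : (⟨s.len c - 1 - (s.len c - 1 - r), by omega⟩ : Fin (s.len c)) = r := by
    ext
    simp only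
    omega
  rw [this]

/-- Induction on the number of columns read, for all `w` at once. The bound for `down w K` supplies
all the inequalities for `t ≤ x`, and `IsMerge.seqCnt_le` turns them into the bound for `w` after
column `K` has been read. -/
theorem seqCnt_le_of_isStandard (hT : IsTabloid T) {d : ℕ} (hd : d ≤ s.numCols)
    {w : Equiv.Perm (Fin n)} (hw : IsStandard w (revPrefix (colSet T) d)) (c : Fin s.numCols)
    (hcd : (c : ℕ) < d) (t : ℕ) :
    seqCnt (s.len c) (scanValue T c d) t ≤ cnt (initSet w (s.len c)) t := by
  induction d generalizing w t with
  | zero => omega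
  | succ d ih =>
    obtain ⟨hdom, hstd⟩ := hw
    let d' : Fin s.numCols := ⟨d, hd⟩
    have hcard := card_colSet hT d'
    rcases (Nat.lt_succ_iff.1 hcd).lt_or_eq with hlt | rfl
    · have hlen : (colSet T d).card ≤ s.len c := by
        rw [show (colSet T d).card = s.len d' from hcard]
        exact s.antitone_len (Fin.le_def.2 hlt.le)
      have h1 := (dom_initSet_down_iff hdom hlen (s.len_le c) _).1
        (fun t => ih (by omega) hstd hlt t)
      obtain ⟨x, htx, h2⟩ := (isMerge_scan hT (c := c) (d := d') hlt).seqCnt_le t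
      rw [seqSeg_entry hT] at h2
      exact h2.trans (h1 x t htx)
    · rw [seqCnt_start hT]
      have := hdom t
      rwa [card_colSet hT c] at this

/-- Just after column `d` has been read, its entries all occur among the endpoints, so the `j`-th
smallest endpoint is at most the `j`-th entry of column `d`. By the row condition it is at most the
`j`-th entry of column `d + 1`, and `IsMerge.exhausted` applies. -/
theorem IsTableau.heights_eq_zero (hT : IsTableau T) {c d : Fin s.numCols} (hcd : c < d) :
    heights T c (s.len c) d = 0 := by
  -- each column is contained in the sequence of scan values just after it has been read
  suffices key : ∀ d : ℕ, (c : ℕ) ≤ d → ∀ hd : d < s.numCols, ∀ j < s.len ⟨d, hd⟩,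
      (∃ i < s.len c, scanValue T c (d + 1) i = entry T ⟨d, hd⟩ j) ∧
        ∀ hd' : d + 1 < s.numCols, heights T c (s.len c) ⟨d + 1, hd'⟩ = 0 by
    obtain ⟨d, hd⟩ := d
    obtain ⟨d, rfl⟩ : ∃ d', d = d' + 1 := ⟨d - 1, by have : (c : ℕ) < d := hcd; omega⟩
    by_cases h0 : 0 < s.len ⟨d, by omega⟩
    · exact (key d (Nat.lt_succ_iff.1 hcd) (by omega) 0 h0).2 hd
    · have h1 : s.len ⟨d + 1, hd⟩ ≤ s.len ⟨d, by omega⟩ :=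
        s.antitone_len (Fin.le_def.2 (Nat.le_succ d))
      have h2 := (isMerge_scan hT.1 hcd).le_size _ le_rfl
      omega
  -- containment of column `d` forces column `d + 1` to be exhausted
  have next : ∀ d : ℕ, (c : ℕ) ≤ d → ∀ hd : d < s.numCols,
      (∀ j < s.len ⟨d, hd⟩, ∃ i < s.len c, scanValue T c (d + 1) i = entry T ⟨d, hd⟩ j) →
        ∀ hd' : d + 1 < s.numCols, heights T c (s.len c) ⟨d + 1, hd'⟩ = 0 := by
    intro d hcd hd hsub hd'
    have hlen : s.len ⟨d + 1, hd'⟩ ≤ s.len ⟨d, hd⟩ := s.antitone_len (Fin.le_def.2 (Nat.le_succ d))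
    have hlen' : s.len ⟨d, hd⟩ ≤ s.len c := s.antitone_len (Fin.le_def.2 hcd)
    have hcd' : c < ⟨d + 1, hd'⟩ := Fin.lt_def.2 (Nat.lt_succ_of_le hcd)
    have H := isMerge_scan hT.1 hcd'
    refine H.exhausted (hlen.trans hlen') fun j hj => ?_
    -- The endpoints decrease with the scan index, so the increasing entries `0, …, j` of the column
    -- occupy decreasing indices; entry `j` therefore has at least `j` indices after its own.
    have h1 : ∀ j < s.len ⟨d, hd⟩, ∃ i < s.len c, i + j + 1 ≤ s.len c ∧
        scanValue T c (d + 1) i = entry T ⟨d, hd⟩ j := by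
      intro j
      induction j with
      | zero =>
        intro hj
        obtain ⟨i, hi, h2⟩ := hsub 0 hj
        exact ⟨i, hi, hi, h2⟩
      | succ j ih =>
        intro hj
        obtain ⟨i, hi, h2, h3⟩ := ih (by omega)
        obtain ⟨i', hi', h4⟩ := hsub (j + 1) hj
        refine ⟨i', hi', ?_, h4⟩
        have h5 := hT.1.entry_lt ⟨d, hd⟩ j (j + 1) (by omega) hj
        rw [← h3, ← h4] at h5
        have h6 : i' < i := by
          by_contra hn
          rcases (not_lt.1 hn).lt_or_eq with h7 | h7
          · have := H.anti _ _ h7 hi'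
            simp only at this
            omega
          · rw [h7] at h5
            omega
        omega
    obtain ⟨i, hi, h2, h3⟩ := h1 j (by omega)
    have h4 : scanValue T c (d + 1) (s.len c - 1 - j) ≤ scanValue T c (d + 1) i := by
      rcases (show i ≤ s.len c - 1 - j by omega).lt_or_eq with h5 | h5
      · exact (H.anti _ _ h5 (by omega)).le
      · rw [h5]
    refine h4.trans ?_
    rw [h3, entry_of_lt T (hj.trans_le hlen), entry_of_lt T hj]
    exact hT.2 _ _ (Fin.le_def.2 (Nat.le_succ d)) j _ _
  have sub : ∀ d : ℕ, (c : ℕ) ≤ d → ∀ hd : d < s.numCols, ∀ j < s.len ⟨d, hd⟩,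
      ∃ i < s.len c, scanValue T c (d + 1) i = entry T ⟨d, hd⟩ j := by
    intro d hcd
    induction d, hcd using Nat.le_induction with
    | base =>
      intro hd j hj
      have hj' : j < s.len c := hj
      refine ⟨s.len c - 1 - j, by omega, ?_⟩
      rw [scanValue_start T c (by omega)]
      congr 1
      omega
    | succ d hcd ih =>
      intro hd j hj
      exact (isMerge_scan hT.1 (c := c) (d := ⟨d + 1, hd⟩)
        (Fin.lt_def.2 (Nat.lt_succ_of_le hcd))).mem_of_exhausted
          (next d hcd (by omega) (ih (by omega)) hd) hj
  exact fun d hcd hd j hj => ⟨sub d hcd hd j hj, next d hcd hd (sub d hcd hd)⟩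

/-- The converse recursion uses `IsMerge.seqCnt_ge`, which needs every column to be exhausted; this
is where the row condition of a tableau enters. -/
theorem isStandard_of_seqCnt_le (hT : IsTableau T) {d : ℕ} (hd : d ≤ s.numCols)
    {w : Equiv.Perm (Fin n)} (hw : ∀ c : Fin s.numCols, (c : ℕ) < d → ∀ t,
      seqCnt (s.len c) (scanValue T c d) t ≤ cnt (initSet w (s.len c)) t) :
    IsStandard w (revPrefix (colSet T) d) := by
  induction d generalizing w with
  | zero => trivial
  | succ d ih =>
    let d' : Fin s.numCols := ⟨d, hd⟩
    have hcard : (colSet T d).card = s.len d' := card_colSet hT.1 d'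
    have hdom : Dom (colSet T d) (initSet w (colSet T d).card) := by
      intro t
      have := hw d' (Nat.lt_succ_self d) t
      rw [hcard]
      rwa [seqCnt_start hT.1] at this
    refine ⟨hdom, ih (by omega) fun c hcd => ?_⟩
    have hlen : (colSet T d).card ≤ s.len c := by
      rw [hcard]
      exact s.antitone_len (Fin.le_def.2 hcd.le)
    refine (dom_initSet_down_iff hdom hlen (s.len_le c) _).2 fun x t htx => ?_
    have hcd' : c < d' := hcd
    have h1 := (isMerge_scan hT.1 hcd').seqCnt_ge (hT.heights_eq_zero hcd') htx
    rw [seqSeg_entry hT.1] at h1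
    exact h1.trans (hw c (by omega) t)

theorem cnt_colSet_le_seqCnt (hT : IsTabloid T) (c : Fin s.numCols) {d : ℕ} (hcd : (c : ℕ) < d)
    (hd : d ≤ s.numCols) (t : ℕ) :
    cnt (colSet T c) t ≤ seqCnt (s.len c) (scanValue T c d) t := by
  induction d, hcd using Nat.le_induction with
  | base => exact (seqCnt_start hT c t).ge
  | succ d hcd ih =>
    refine (ih (by omega)).trans (card_le_card fun i hi => ?_)
    rw [mem_filter, mem_range] at hi ⊢
    exact ⟨hi.1, hi.2.trans ((isMerge_scan hT (c := c) (d := ⟨d, hd⟩) hcd).le hi.1)⟩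

/-- A violation in row `r` gives at least `len c - r` endpoints that are at least `T c r`, and at
least `r + 1` entries of column `d` below it. This is more than the `len c` elements of the initial
set, against the inequality at `t = 0`. -/
theorem IsTabloid.le_of_isStandard (hT : IsTabloid T) {e : ℕ} (he : e ≤ s.numCols)
    {w : Equiv.Perm (Fin n)} (hw : IsStandard w (revPrefix (colSet T) e)) {c d : Fin s.numCols}
    (hcd : c ≤ d) (hde : (d : ℕ) < e) (r : ℕ) (hc : r < s.len c) (hd : r < s.len d) :
    T c ⟨r, hc⟩ ≤ T d ⟨r, hd⟩ := by
  induction e generalizing w with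
  | zero => omega
  | succ e ih =>
    obtain ⟨hdom, hstd⟩ := hw
    rcases (Nat.lt_succ_iff.1 hde).lt_or_eq with hlt | rfl
    · exact ih (by omega) hstd hlt
    rcases hcd.lt_or_eq with hlt | rfl
    swap
    · exact le_rfl
    have hlen : (colSet T d).card ≤ s.len c := by
      rw [card_colSet hT d]
      exact s.antitone_len hcd
    have h1 := (dom_initSet_down_iff hdom hlen (s.len_le c) _).1
      (fun t => seqCnt_le_of_isStandard hT (by omega) hstd c hlt t)
    by_contra hn
    push Not at hn
    have hn' : (T d ⟨r, hd⟩ : ℕ) < T c ⟨r, hc⟩ := hn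
    have h2 := h1 (T c ⟨r, hc⟩) 0 (Nat.zero_le _)
    rw [cnt_zero, card_initSet w (s.len_le c)] at h2
    have h3 := cnt_colSet_le_seqCnt hT c hlt d.2.le (T c ⟨r, hc⟩)
    have h4 : (Ici (⟨r, hc⟩ : Fin (s.len c))).card ≤ cnt (colSet T c) (T c ⟨r, hc⟩) := by
      rw [colSet_val, cnt_image (hT c).injective]
      refine card_le_card fun i hi => ?_
      rw [mem_filter]
      exact ⟨mem_univ _, (hT c).monotone (mem_Ici.1 hi)⟩
    have h5 : (Iic (⟨r, hd⟩ : Fin (s.len d))).card ≤ seg (colSet T d) 0 (T c ⟨r, hc⟩) := by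
      rw [colSet_val, seg_image (hT d).injective]
      refine card_le_card fun i hi => ?_
      rw [mem_filter]
      have h6 : (T d i : ℕ) ≤ T d ⟨r, hd⟩ := (hT d).monotone (mem_Iic.1 hi)
      exact ⟨mem_univ _, Nat.zero_le _, by omega⟩
    rw [Fin.card_Ici] at h4
    rw [Fin.card_Iic] at h5
    simp only at h4 h5
    omega

/-- Standardness of the sequence of columns of a tabloid amounts to the tabloid being a tableau
whose scanning tableau is dominated by the initial sets of `w`. -/
theorem isStandard_iff (hT : IsTabloid T) (w : Equiv.Perm (Fin n)) :
    IsStandard w (revPrefix (colSet T) s.numCols) ↔ IsTableau T ∧ ∀ c t,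
      seqCnt (s.len c) (scanValue T c s.numCols) t ≤ cnt (initSet w (s.len c)) t :=
  ⟨fun h => ⟨⟨hT, fun _ d hcd r hc hd => hT.le_of_isStandard le_rfl h hcd d.2 r hc hd⟩,
    fun c t => seqCnt_le_of_isStandard hT le_rfl h c c.2 t⟩,
    fun h => isStandard_of_seqCnt_le h.1 le_rfl fun c _ => h.2 c⟩

end ScanningValues


/-! ### Keys, the Demazure quotient and the two halves of the theorem -/

section Comparison

variable {n : ℕ} {Q : Finset ℕ}

/-- Every `Q`-chain comes from a permutation. -/
theorem QChain.exists_perm (π : QChain n Q) :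
    ∃ w : Equiv.Perm (Fin n), ∀ q, initSet w q.1 = π.P q := by
  let S : ℕ → Finset (Fin n) := fun q =>
    open Classical in univ.filter fun x => n ≤ q ∨ ∃ p, p.1 ≤ q ∧ x ∈ π.P p
  have hS : Monotone S := by
    intro q q' hqq' x
    simp only [S, mem_filter, mem_univ, true_and]
    rintro (h | ⟨p, hp, hx⟩)
    · exact Or.inl (h.trans hqq')
    · exact Or.inr ⟨p, hp.trans hqq', hx⟩
  have hSP : ∀ q, S q.1 = π.P q := by
    intro q
    ext x
    simp only [S, mem_filter, mem_univ, true_and]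
    constructor
    · rintro (h | ⟨p, hp, hx⟩)
      · have : π.P q = univ := by
          rw [← card_eq_iff_eq_univ, Fintype.card_fin]
          exact le_antisymm (card_le_size _) (h.trans_eq (π.card_P q).symm)
        rw [this]
        exact mem_univ x
      · exact π.strictMono_P.monotone (show p ≤ q from hp) hx
    · exact fun h => Or.inr ⟨q, le_rfl, h⟩
  obtain ⟨w, hw⟩ := exists_perm_initSet S hS
  refine ⟨w, fun q => ?_⟩
  rw [hw q.1 ((π.card_P q).symm.trans_le (card_le_size _)) ((congrArg card (hSP q)).trans
    (π.card_P q)), hSP]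

variable {π : QChain n Q} {s : Shape n} {hs : s.lengths ⊆ Q}

theorem QChain.key_strictMono (c : Fin s.numCols) : StrictMono (π.key s hs c) := by
  unfold QChain.key QChain.column
  split_ifs
  · exact OrderEmbedding.strictMono _
  · exact OrderEmbedding.strictMono _

theorem QChain.image_key {w : Equiv.Perm (Fin n)} (hw : ∀ q, initSet w q.1 = π.P q)
    (c : Fin s.numCols) : univ.image (π.key s hs c) = initSet w (s.len c) := by
  by_cases h : s.len c ∈ Q
  · have hk : π.key s hs c = (π.P ⟨s.len c, h⟩).orderEmbOfFin (π.card_P ⟨s.len c, h⟩) := by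
      rw [QChain.key, QChain.column, dif_pos h]
    rw [hk, image_orderEmbOfFin_univ, ← hw]
  · have hn : s.len c = n := (Shape.len_mem_or hs c).resolve_left h
    have h1 : univ.image (π.key s hs c) = univ := by
      rw [← card_eq_iff_eq_univ, card_image_of_injective _ (π.key_strictMono c).injective, card_univ,
        Fintype.card_fin, Fintype.card_fin, hn]
    have h2 : initSet w (s.len c) = univ := by
      rw [← card_eq_iff_eq_univ, card_initSet w (s.len_le c), Fintype.card_fin, hn]
    rw [h1, h2]

theorem cnt_initSet_key {w : Equiv.Perm (Fin n)} (hw : ∀ q, initSet w q.1 = π.P q)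
    (c : Fin s.numCols) (t : ℕ) :
    cnt (initSet w (s.len c)) t = (univ.filter fun r => t ≤ (π.key s hs c r : ℕ)).card := by
  rw [← π.image_key hw c, cnt_image (π.key_strictMono c).injective]

theorem le_key_iff {w : Equiv.Perm (Fin n)} (hw : ∀ q, initSet w q.1 = π.P q) {T : Filling s}
    (hT : IsTabloid T) : T ≤ π.key s hs ↔
      ∀ I ∈ revPrefix (colSet T) s.numCols, Dom I (initSet w I.card) := by
  have h1 : T ≤ π.key s hs ↔ ∀ c : Fin s.numCols, Dom (colSet T c) (initSet w (s.len c)) := by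
    refine forall_congr' fun c => ?_
    have := forall_le_iff_card_le (f := fun r => (T c r : ℕ)) (g := fun r => (π.key s hs c r : ℕ))
      (hT c).monotone (π.key_strictMono c).monotone
    simp only [Dom, cnt_initSet_key (hs := hs) hw, colSet_val, cnt_image (hT c).injective]
    exact this
  rw [h1]
  constructor
  · intro h I hI
    obtain ⟨c, hc, rfl⟩ := mem_revPrefix.1 hI
    have := card_colSet hT ⟨c, hc⟩
    rw [show (colSet T c).card = s.len ⟨c, hc⟩ from this]
    exact h ⟨c, hc⟩
  · intro h c
    have := h _ (mem_revPrefix.2 ⟨c, c.2, rfl⟩)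
    rwa [card_colSet hT c] at this

/-- The rows of the scanning tableau are the scan indices in reverse order, so entrywise comparison
with the key becomes the counting condition of `isStandard_iff`. -/
theorem isDemazure_iff {w : Equiv.Perm (Fin n)} (hw : ∀ q, initSet w q.1 = π.P q) {T : Filling s}
    (hT : IsTabloid T) :
    IsDemazure π s hs T ↔ IsStandard w (revPrefix (colSet T) s.numCols) := by
  rw [isStandard_iff hT, IsDemazure]
  refine and_congr_right fun _ => forall_congr' fun c => ?_
  have hm : Monotone fun r : Fin (s.len c) => scanValue T c s.numCols (s.len c - 1 - r) := by
    intro r r' hr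
    have h2 : (r : ℕ) ≤ r' := hr
    rcases (show s.len c - 1 - r' ≤ s.len c - 1 - r by omega).lt_or_eq with h1 | h1
    · exact (scanValue_anti hT c c.2 le_rfl _ _ h1 (by omega)).le
    · exact (congrArg _ h1.symm).le
  have := forall_le_iff_card_le (g := fun r => (π.key s hs c r : ℕ)) hm
    (π.key_strictMono c).monotone
  simp only [scanningTableau_eq, cnt_initSet_key (hs := hs) hw, ← card_filter_reverse]
  exact this

/-- The column lengths of a shape, last column first. -/
def Shape.revLens (s : Shape n) : List ℕ :=
  revPrefix (fun j => if h : j < s.numCols then s.len ⟨j, h⟩ else 0) s.numCols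

theorem Shape.pairwise_revLens (s : Shape n) : s.revLens.Pairwise (· ≤ ·) := by
  refine pairwise_revPrefix (fun i j hij => ?_) _
  by_cases hj : j < s.numCols
  · simp only [dif_pos hj, dif_pos (hij.trans_lt hj)]
    exact s.antitone_len (Fin.le_def.2 hij)
  · simp only [dif_neg hj, Nat.zero_le]

theorem map_card_colSet {T : Filling s} (hT : IsTabloid T) :
    (revPrefix (colSet T) s.numCols).map card = s.revLens := by
  rw [map_revPrefix, Shape.revLens, revPrefix_inj]
  intro j hj
  rw [dif_pos hj]
  exact card_colSet hT ⟨j, hj⟩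

theorem exists_tabloid {G : List (Finset (Fin n))} (hG : G.map card = s.revLens) :
    ∃ T : Filling s, IsTabloid T ∧ G = revPrefix (colSet T) s.numCols := by
  obtain ⟨f, hf⟩ := exists_eq_revPrefix G
  have hlen : G.length = s.numCols := by
    have := congrArg List.length hG
    rwa [List.length_map, Shape.revLens, length_revPrefix] at this
  rw [hlen] at hf
  rw [hf, map_revPrefix, Shape.revLens, revPrefix_inj] at hG
  have hcard : ∀ c : Fin s.numCols, (f c).card = s.len c := fun c => by
    have := hG c c.2
    rwa [dif_pos c.2] at this
  refine ⟨fun c => (f c).orderEmbOfFin (hcard c), fun c => OrderEmbedding.strictMono _, ?_⟩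
  rw [hf, revPrefix_inj]
  intro j hj
  rw [colSet, dif_pos hj, image_orderEmbOfFin_univ]

theorem colSet_injective {T U : Filling s} (hT : IsTabloid T) (hU : IsTabloid U)
    (h : revPrefix (colSet T) s.numCols = revPrefix (colSet U) s.numCols) : T = U := by
  funext c
  have h1 := revPrefix_inj.1 h c c.2
  rw [colSet_val, colSet_val] at h1
  have h2 := congrArg (fun A : Finset (Fin n) => (A : Set (Fin n))) h1
  simp only [coe_image, coe_univ, Set.image_univ] at h2
  exact ((hT c).range_inj (hU c)).1 h2

/-- The generic matrix. -/
def genericMatrix (R : Type*) [CommRing R] (n : ℕ) :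
    Matrix (Fin n) (Fin n) (MvPolynomial (Fin n × Fin n) R) :=
  Matrix.of fun i j => MvPolynomial.X (i, j)

theorem listMon_revPrefix {S : Type*} [CommRing S] (X : Matrix (Fin n) (Fin n) S)
    (f : ℕ → Finset (Fin n)) (d : ℕ) :
    listMon X (revPrefix f d) = ∏ j ∈ range d, setMinor X (f j) := by
  induction d with
  | zero => rfl
  | succ d ih =>
    rw [prod_range_succ, ← ih, mul_comm]
    simp [listMon, revPrefix]

theorem tabMonomial_eq (R : Type*) [CommRing R] {T : Filling s} (hT : IsTabloid T) :
    tabMonomial R T = listMon (genericMatrix R n) (revPrefix (colSet T) s.numCols) := by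
  rw [listMon_revPrefix, prod_range]
  refine prod_congr rfl fun c _ => ?_
  rw [colSet_val, ← minor_of_strictMono _ (s.len_le c) (hT c)]
  rfl

theorem eval_listMon {K : Type*} [CommRing K] (M : Matrix (Fin n) (Fin n) K)
    (F : List (Finset (Fin n))) :
    MvPolynomial.aeval (R := K) (fun x => M x.1 x.2) (listMon (genericMatrix K n) F) =
      listMon M F := by
  rw [← AlgHom.coe_toRingHom, map_listMon]
  congr 1
  ext i j
  simp [genericMatrix]

/-- Each generator has a column not dominated by `w`, and its minor vanishes below `w`. Evaluation
at such a matrix is thus well defined on the Demazure quotient. -/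
theorem eval_eq_zero_of_mem_ZSub {K : Type*} [CommRing K] {w : Equiv.Perm (Fin n)}
    (hw : ∀ q, initSet w q.1 = π.P q) {M : Matrix (Fin n) (Fin n) K} (hM : IsBelow w M)
    {z : Gam K s} (hz : z ∈ ZSub K π s hs) :
    MvPolynomial.aeval (R := K) (fun x => M x.1 x.2) z.1 = 0 := by
  let φ : Gam K s →ₗ[K] K :=
    (MvPolynomial.aeval (R := K) (fun x : Fin n × Fin n => M x.1 x.2)).toLinearMap ∘ₗ
      (Gam K s).subtype
  suffices h : ZSub K π s hs ≤ LinearMap.ker φ from h hz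
  refine Submodule.span_le.2 ?_
  rintro _ ⟨T, hT, hle, rfl⟩
  rw [le_key_iff hw hT] at hle
  push Not at hle
  obtain ⟨I, hI, hI'⟩ := hle
  change MvPolynomial.aeval _ (tabMonomial K T) = 0
  rw [tabMonomial_eq K hT, eval_listMon, listMon]
  exact List.prod_eq_zero (List.mem_map.2 ⟨I, hI, setMinor_eq_zero hM hI'⟩)

variable (π s hs)

theorem span_demazureMonomial (R : Type*) [CommRing R] :
    Submodule.span R (Set.range (demazureMonomial R π s hs)) = ⊤ := by
  obtain ⟨w, hw⟩ := π.exists_perm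
  have key : ∀ p ∈ Submodule.span R {y | ∃ G : List (Finset (Fin n)), G.map card = s.revLens ∧
      (IsStandard w G ∨ ∃ I ∈ G, ¬ Dom I (initSet w I.card)) ∧ y = listMon (genericMatrix R n) G},
      ∃ h : p ∈ Gam R s, (ZSub R π s hs).mkQ ⟨p, h⟩ ∈
        Submodule.span R (Set.range (demazureMonomial R π s hs)) := by
    intro p hp
    induction hp using Submodule.span_induction with
    | mem p hp =>
      obtain ⟨G, hG, hor, rfl⟩ := hp
      obtain ⟨T, hT, rfl⟩ := exists_tabloid hG
      rw [← tabMonomial_eq R hT]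
      refine ⟨Submodule.subset_span ⟨T, hT, rfl⟩, ?_⟩
      rcases hor with h | ⟨I, hI, hI'⟩
      · exact Submodule.subset_span ⟨⟨T, (isDemazure_iff hw hT).2 h⟩, rfl⟩
      · have : gamMonomial R T hT ∈ ZSub R π s hs := by
          refine Submodule.subset_span ⟨T, hT, fun hle => ?_, rfl⟩
          exact hI' ((le_key_iff hw hT).1 hle I hI)
        rw [← Submodule.Quotient.mk_eq_zero] at this
        change Submodule.Quotient.mk (gamMonomial R T hT) ∈ _
        rw [this]
        exact zero_mem _
    | zero => exact ⟨zero_mem _, by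
        rw [show (⟨0, zero_mem _⟩ : Gam R s) = 0 from rfl, map_zero]
        exact zero_mem _⟩
    | add p q _ _ hp hq =>
      obtain ⟨hp, hp'⟩ := hp
      obtain ⟨hq, hq'⟩ := hq
      exact ⟨add_mem hp hq, add_mem hp' hq'⟩
    | smul r p _ hp =>
      obtain ⟨hp, hp'⟩ := hp
      exact ⟨Submodule.smul_mem _ r hp, Submodule.smul_mem _ r hp'⟩
  have hGam : Gam R s ≤ Submodule.span R {y | ∃ G : List (Finset (Fin n)),
      G.map card = s.revLens ∧ (IsStandard w G ∨ ∃ I ∈ G, ¬ Dom I (initSet w I.card)) ∧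
        y = listMon (genericMatrix R n) G} := by
    refine Submodule.span_le.2 ?_
    rintro _ ⟨T, hT, rfl⟩
    rw [tabMonomial_eq R hT]
    exact listMon_mem_span R _ s.pairwise_revLens w (map_card_colSet hT)
  rw [eq_top_iff]
  rintro x -
  obtain ⟨⟨p, hp⟩, rfl⟩ := Submodule.mkQ_surjective _ x
  exact (key p (hGam hp)).2

theorem linearIndependent_demazureMonomial (K : Type*) [Field K] [Infinite K] :
    LinearIndependent K (demazureMonomial K π s hs) := by
  classical
  obtain ⟨w, hw⟩ := π.exists_perm
  rw [linearIndependent_iff']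
  intro A g hg
  let cols : {T : Filling s // IsDemazure π s hs T} → List (Finset (Fin n)) :=
    fun T => revPrefix (colSet T.1) s.numCols
  have hinj : Function.Injective cols := fun T U h =>
    Subtype.ext (colSet_injective T.2.1.1 U.2.1.1 h)
  have hz : ∑ T ∈ A, g T • gamMonomial K T.1 T.2.1.1 ∈ ZSub K π s hs := by
    rw [← Submodule.Quotient.mk_eq_zero, ← Submodule.mkQ_apply, map_sum]
    exact hg
  have h0 := eq_zero_of_isStandard w (A.image cols) (L := s.revLens) (by
    intro F hF
    obtain ⟨T, -, rfl⟩ := mem_image.1 hF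
    exact ⟨map_card_colSet T.2.1.1, (isDemazure_iff hw T.2.1.1).1 T.2⟩)
    -- Coefficients are carried from tableaux to lists of column sets, which determine the tabloid;
    -- the value `0` on other lists plays no role.
    (Function.extend cols g 0) (by
    intro M hM
    rw [sum_image hinj.injOn, ← eval_eq_zero_of_mem_ZSub hw hM hz]
    rw [Submodule.coe_sum, map_sum]
    refine sum_congr rfl fun T _ => ?_
    rw [hinj.extend_apply, Submodule.coe_smul, map_smul, smul_eq_mul]
    congr 1
    change _ = MvPolynomial.aeval _ (tabMonomial K T.1)
    rw [tabMonomial_eq K T.2.1.1, eval_listMon])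
  intro T hT
  rw [← hinj.extend_apply g 0 T]
  exact h0 _ (mem_image_of_mem _ hT)

end Comparison

end

/-- For every `Q`-chain `π`, the monomials of the `π`-Demazure tableaux of shape `λ` generate the
Demazure quotient over every commutative ring, and form a basis of it over every field of
characteristic zero. -/
theorem theorem2 (n : ℕ) (hn : 2 ≤ n) (Q : Finset ℕ) (hQne : Q.Nonempty)
    (hQ : Q ⊆ Finset.Icc 1 (n - 1)) (lam : NPartition n) (hlam : lam.shape.lengths ⊆ Q)
    (π : QChain n Q) :
    (∀ (R : Type*) [CommRing R],
      Submodule.span R (Set.range (demazureMonomial R π lam.shape hlam)) = ⊤) ∧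
    (∀ (K : Type*) [Field K] [CharZero K],
      ∃ b : Module.Basis {T : Filling lam.shape // IsDemazure π lam.shape hlam T} K
          (DemazureQuotient K π lam.shape hlam),
        ∀ T, b T = demazureMonomial K π lam.shape hlam T) := by
  refine ⟨fun R _ => span_demazureMonomial π lam.shape hlam R, fun K _ _ => ?_⟩
  have : Infinite K := CharZero.infinite K
  refine ⟨Module.Basis.mk (linearIndependent_demazureMonomial π lam.shape hlam K)
    (span_demazureMonomial π lam.shape hlam K).ge, fun T => ?_⟩
  rw [Module.Basis.mk_apply]
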